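/- **Setting.** There are $n\ge1$ agents and a horizon $H\ge1$. Agent $i$ has a finite local state space $S_i$, a finite nonempty local action space $A_i$, local transition kernels $P_{i,h}(\cdot\mid s_i,a_i)$, an initial distribution $\rho_i$ on $S_i$, and stage rewards $r_{i,h}:S\times A\to[0,1]$, where $S=\prod_iS_i$, $A=\prod_iA_i$. The agents' states evolve independently given the local states and actions (decoupled dynamics), and policies are local: $a_{i,h}\sim\pi_{i,h}(\cdot\mid s_{i,h})$. Let $J_i(\pi)=\mathbb E^\pi\sum_{h=1}^H r_{i,h}(s_h,a_h)$, let $d^\pi_{i,h}(s_i)$ be the probability that $s_{i,h}=s_i$ under $\pi$, and let $$\text{NE-Gap}(\pi)=\sum_{i=1}^n\Big(\max_{\pi_i'}J_i(\pi_i',\pi_{-i})-J_i(\pi)\Big).$$ Assume that the game is a Markov potential game with stage potentials $\phi_h:S\times A\to\mathbb R$, i.e. for all $i,h,s,a,s_i',a_i'$, $$r_{i,h}(s_i',s_{-i},a_i',a_{-i})-r_{i,h}(s,a)=\phi_h(s_i',s_{-i},a_i',a_{-i})-\phi_h(s,a).$$ Put $\Phi(\pi)=\mathbb E^\pi\sum_{h=1}^H\phi_h(s_h,a_h)$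 and let $\Phi_{\max},\Phi_{\min}$ be its maximum and minimum over local joint policies. Assume sufficient exploration: there is $c>0$ with $d^\pi_{i,h}(s_i)>c$ for all local $\pi$ and all $i,h,s_i$. **Algorithm (MA-SPI).** Sample $T_K$ independent trajectories with uniformly random actions. Let $\widehat P_{i,h}(s_i'\mid s_i,a_i)$ be the empirical transition frequencies ($\mathbf 1\{s_i'=s_i\}$ if $(s_i,a_i)$ was not visited at step $h$). Start from any local policy $\pi^{(1)}$. In round $t=1,2,\dots$ sample $T_J$ fresh independent trajectories $(s^{(k)},a^{(k)})$ under $\pi^{(t)}$. Let $\widehat r_{i,h}(s_i,a_i)$ be the average of $r_{i,h}(s_i,s_{-i,h}^{(k)},a_i,a_{-i,h}^{(k)})$ over those $k$ with $s_{i,h}^{(k)}=s_i$ ($0$ if there are none). Compute $\widehat Q_{i,H+1}=0$, $$\widehat Q_{i,h}(s_i,a_i)=\widehat r_{i,h}(s_i,a_i)+\sum_{s_i',a_i'}\widehat P_{i,h}(s_i'\mid s_i,a_i)\,\pi^{(t)}_{i,h+1}(a_i'\mid s_i')\,\widehat Q_{i,h+1}(s_i',a_i'),$$ and update, with $\eta_t=1/\sqrt{4n^2H^3t}$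 and ties broken arbitrarily, $$\pi^{(t+1)}_{i,h}(a_i\mid s_i)=(1-\eta_t)\pi^{(t)}_{i,h}(a_i\mid s_i)+\eta_t\mathbf 1\{a_i=\arg\max_{a'}\widehat Q_{i,h}(s_i,a')\}.$$ Running $T_G$ rounds uses $T_GT_J+T_K$ sampled trajectories. **Theorem.** Let $0<\epsilon\le1$ and $0<\delta<1$. (a) Suppose that $$T_G\ge\frac{64n^2H^3\big((\Phi_{\max}-\Phi_{\min}+1)/2+\ln(8nH^{3/2}c^{-1}\epsilon^{-1})\big)^2}{c^2\epsilon^2},$$ $$T_J\ge\frac{2048\,n^2H^4\ln\big(8\delta^{-1}nHT_G\sum_i|S_i||A_i|\big)}{c^4\epsilon^2},$$ $$T_K\ge\frac{2048\,n^2\max_i|S_i|^2\max_i|A_i|^2H^6\ln\big(8\delta^{-1}nHT_G\sum_i|S_i|^2|A_i|\big)}{c^4\epsilon^2}.$$ Then with probability at least $1-\delta$ the iterates satisfy both $$\sum_{t=1}^{T_G}\frac1{\sqrt t}\text{NE-Gap}(\pi^{(t)})\le\frac{\epsilon\sqrt{T_G}}2+\frac{\epsilon}{2}\sum_{t=1}^{T_G}\frac1{\sqrt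 t}\qquad\text{and}\qquad\min_{1\le t\le T_G}\text{NE-Gap}(\pi^{(t)})\le\epsilon.$$ (b) There are universal constants $C>0$ and $k\in\mathbb N$ such that, for every such game and all such $\epsilon,\delta$, there are $T_G,T_J,T_K$ satisfying the conditions in (a) for which the number of sampled trajectories satisfies $$T_GT_J+T_K\le C\,L^k\left(\frac{(1+\Phi_{\max}-\Phi_{\min})^2\,n^4H^7}{c^6\epsilon^4}+\frac{n^2\max_i|S_i|^2\max_i|A_i|^2H^6}{c^4\epsilon^2}\right),$$ where $L=1+\ln\frac{nH\max_i|S_i|\max_i|A_i|}{c\,\epsilon\,\delta}$. That is, for a bounded potential range the sample complexity is $\widetilde O\big(n^4H^7/(c^6\epsilon^4)+n^2\max_i|S_i|^2\max_i|A_i|^2H^6/(c^4\epsilon^2)\big)$. -/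

import Mathlib

open scoped ENNReal BigOperators

noncomputable section

namespace MASPI

/-! ### Finite probability -/

/-- The product of finitely many probability distributions on finite types
(independent coordinates). -/
def prodPMF {ι : Type*} [Fintype ι] [DecidableEq ι] {X : ι → Type*} [∀ i, Fintype (X i)]
    (p : ∀ i, PMF (X i)) : PMF (∀ i, X i) :=
  PMF.ofFintype (fun x => ∏ i, p i (x i)) (by
    have h := Finset.prod_univ_sum (fun i => (Finset.univ : Finset (X i))) (fun i x => p i x)
    rw [Fintype.piFinset_univ] at h
    rw [← h]
    refine Finset.prod_eq_one fun i _ => ?_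
    rw [← tsum_fintype (L := .unconditional _)]
    exact (p i).tsum_coe)

/-- Expectation of a real function under a distribution on a finite type. -/
def expect {α : Type*} [Fintype α] (p : PMF α) (f : α → ℝ) : ℝ :=
  ∑ x, (p x).toReal * f x

/-- The mixture `(1 - η) p + η q` for `0 ≤ η ≤ 1`. -/
def mix {α : Type*} [Fintype α] (η : ℝ) (h0 : 0 ≤ η) (h1 : η ≤ 1) (p q : PMF α) : PMF α :=
  PMF.ofFintype (fun a => ENNReal.ofReal (1 - η) * p a + ENNReal.ofReal η * q a) (by
    have hp : ∑ a, p a = 1 := by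
      rw [← tsum_fintype (L := .unconditional _)]; exact p.tsum_coe
    have hq : ∑ a, q a = 1 := by
      rw [← tsum_fintype (L := .unconditional _)]; exact q.tsum_coe
    rw [Finset.sum_add_distrib, ← Finset.mul_sum, ← Finset.mul_sum, hp, hq, mul_one, mul_one,
      ← ENNReal.ofReal_add (by linarith) h0]
    simp)

/-- The step size `η_t = 1 / √(4 n² H³ t)`. -/
def stepSize (n H t : ℕ) : ℝ := 1 / Real.sqrt (4 * (n : ℝ) ^ 2 * (H : ℝ) ^ 3 * (t : ℝ))

theorem stepSize_nonneg (n H t : ℕ) : 0 ≤ stepSize n H t := by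
  unfold stepSize; positivity

theorem stepSize_le_one (n H t : ℕ) : stepSize n H t ≤ 1 := by
  unfold stepSize
  have hc : 4 * (n : ℝ) ^ 2 * (H : ℝ) ^ 3 * (t : ℝ) = ((4 * n ^ 2 * H ^ 3 * t : ℕ) : ℝ) := by
    push_cast; ring
  rw [hc]
  rcases Nat.eq_zero_or_pos (4 * n ^ 2 * H ^ 3 * t) with h | h
  · rw [h]; simp
  · have h1 : (1 : ℝ) ≤ ((4 * n ^ 2 * H ^ 3 * t : ℕ) : ℝ) := by exact_mod_cast h
    have h2 : 1 ≤ Real.sqrt ((4 * n ^ 2 * H ^ 3 * t : ℕ) : ℝ) := Real.one_le_sqrt.mpr h1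
    exact div_le_one_of_le₀ h2 (by positivity)

/-! ### Markov games with decoupled dynamics

Horizon steps `1, …, H` are indexed by `Fin H`, that is, by `0, …, H - 1`. -/

/-- An `n`-agent Markov game with decoupled dynamics and horizon `H`: agent `i` has the local
state space `S i`, the local action space `A i`, the local transition kernels `P i h`, the stage
rewards `r i h` with values in `[0, 1]`, the initial local state distribution `ρ i`; `v h` is the
social welfare. (The kernel of the last step is never used.) -/
structure Game (n H : ℕ) (S A : Fin n → Type*) where
  P : ∀ i, Fin H → S i → A i → PMF (S i)
  r : Fin n → Fin H → (∀ i, S i) → (∀ i, A i) → ℝ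
  r_nonneg : ∀ i h s a, 0 ≤ r i h s a
  r_le_one : ∀ i h s a, r i h s a ≤ 1
  ρ : ∀ i, PMF (S i)
  v : Fin H → (∀ i, S i) → (∀ i, A i) → ℝ

/-- A local policy of one agent: a distribution over local actions for every step and every
local state. -/
abbrev AgentPolicy (H : ℕ) (Si Ai : Type*) := Fin H → Si → PMF Ai

/-- A joint policy of the local policy class. -/
abbrev Policy {n : ℕ} (H : ℕ) (S A : Fin n → Type*) := ∀ i, AgentPolicy H (S i) (A i)

/-- A trajectory of length `m`: the local state and the local action of every agent at every
step. -/
abbrev Traj {n : ℕ} (m : ℕ) (S A : Fin n → Type*) := Fin m → ∀ i, S i × A i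

/-- The uniformly random joint policy. -/
def unifPolicy {n : ℕ} (H : ℕ) (S A : Fin n → Type*) [∀ i, Fintype (A i)]
    [∀ i, Nonempty (A i)] : Policy H S A :=
  fun i _ _ => PMF.uniformOfFintype (A i)

section Model

variable {n H : ℕ} {S A : Fin n → Type*} [∀ i, Fintype (S i)] [∀ i, Fintype (A i)]

/-- The distribution of the global state that follows a trajectory of length `m < H`: the initial
distribution if `m = 0`, otherwise given by the local kernels, independently over the agents. -/
def nextState (M : Game n H S A) : (m : ℕ) → m < H → Traj m S A → PMF (∀ i, S i)
  | 0, _, _ => prodPMF M.ρ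
  | m + 1, hm, τ =>
      prodPMF fun i =>
        M.P i ⟨m, Nat.lt_of_succ_lt hm⟩ (τ (Fin.last m) i).1 (τ (Fin.last m) i).2

/-- The distribution of the first `m` steps of the game played with the joint policy `π`. -/
def trajLawAux (M : Game n H S A) (π : Policy H S A) : (m : ℕ) → m ≤ H → PMF (Traj m S A)
  | 0, _ => PMF.pure Fin.elim0
  | m + 1, hm =>
      (trajLawAux M π m (Nat.le_of_succ_le hm)).bind fun τ =>
        (nextState M m hm τ).bind fun s =>
          (prodPMF fun i => π i ⟨m, hm⟩ (s i)).bind fun a =>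
            PMF.pure (Fin.snoc (α := fun _ => ∀ i, S i × A i) τ fun i => (s i, a i))

/-- The distribution of the whole trajectory under the joint policy `π`. -/
def trajLaw (M : Game n H S A) (π : Policy H S A) : PMF (Traj H S A) :=
  trajLawAux M π H le_rfl

/-- The expected total of the stage functions `f h (s_h, a_h)` under `π`. -/
def totalValue (M : Game n H S A) (f : Fin H → (∀ i, S i) → (∀ i, A i) → ℝ)
    (π : Policy H S A) : ℝ :=
  expect (trajLaw M π) fun τ => ∑ h, f h (fun i => (τ h i).1) (fun i => (τ h i).2)

/-- The total reward `J_i(π)` of agent `i`. -/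
def J (M : Game n H S A) (i : Fin n) (π : Policy H S A) : ℝ := totalValue M (M.r i) π

open Classical in
/-- The probability `d_{i,h}^π(s)` that agent `i` is in the local state `s` at step `h`. -/
def visitProb (M : Game n H S A) (π : Policy H S A) (i : Fin n) (h : Fin H) (s : S i) : ℝ :=
  expect (trajLaw M π) fun τ => if (τ h i).1 = s then 1 else 0

/-- The gap of agent `i`. The supremum over the policies of agent `i` is a maximum: it is that of
a bounded continuous function over a compact set. -/
def agentGap (M : Game n H S A) (i : Fin n) (π : Policy H S A) : ℝ :=
  (⨆ π' : AgentPolicy H (S i) (A i), J M i (Function.update π i π')) - J M i π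

/-- The Nash gap of a joint policy. -/
def neGap (M : Game n H S A) (π : Policy H S A) : ℝ := ∑ i, agentGap M i π

/-- `φ` is a family of stage potential functions of the game: a change of the local state and
action of one agent changes its stage reward and the stage potential by the same amount. A Markov
potential game is one that has such a family. -/
def IsStagePotential (M : Game n H S A) (φ : Fin H → (∀ i, S i) → (∀ i, A i) → ℝ) : Prop :=
  ∀ (i : Fin n) (h : Fin H) (s : ∀ i, S i) (a : ∀ i, A i) (s' : S i) (a' : A i),
    M.r i h (Function.update s i s') (Function.update a i a') - M.r i h s a
      = φ h (Function.update s i s') (Function.update a i a') - φ h s a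

/-- `Φ_max - Φ_min`, where `Φ(π)` is the total potential and the extrema are over all local joint
policies (they are attained). -/
def potentialRange (M : Game n H S A) (φ : Fin H → (∀ i, S i) → (∀ i, A i) → ℝ) : ℝ :=
  (⨆ π : Policy H S A, totalValue M φ π) - (⨅ π : Policy H S A, totalValue M φ π)

/-- Sufficient exploration with the constant `c`. -/
def SufficientExploration (M : Game n H S A) (c : ℝ) : Prop :=
  0 < c ∧ ∀ (π : Policy H S A) (i : Fin n) (h : Fin H) (s : S i), c < visitProb M π i h s

/-! ### Multi-agent soft policy iteration -/

/-- A dataset of `T` trajectories. -/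
abbrev Dataset (T H : ℕ) {n : ℕ} (S A : Fin n → Type*) := Fin T → Traj H S A

/-- `T` independent trajectories under the policy `π`. -/
def sampleData (M : Game n H S A) (T : ℕ) (π : Policy H S A) : PMF (Dataset T H S A) :=
  prodPMF fun _ : Fin T => trajLaw M π

open Classical in
/-- The number of trajectories in `D` with `s_{i,h} = s` and `a_{i,h} = a`. -/
def countSA {T : ℕ} (D : Dataset T H S A) (i : Fin n) (h : Fin H) (s : S i) (a : A i) : ℕ :=
  (Finset.univ.filter fun k : Fin T => D k h i = (s, a)).card

open Classical in
/-- The number of trajectories in `D` with `s_{i,h+1} = s'`, `s_{i,h} = s` and `a_{i,h} = a`. -/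
def countSAS {T : ℕ} (D : Dataset T H S A) (i : Fin n) (h : Fin H) (s : S i) (a : A i)
    (s' : S i) : ℕ :=
  (Finset.univ.filter fun k : Fin T =>
    D k h i = (s, a) ∧ ∃ hh : (h : ℕ) + 1 < H, (D k ⟨h + 1, hh⟩ i).1 = s').card

open Classical in
/-- The number of trajectories in `D` with `s_{i,h} = s`. -/
def countS {T : ℕ} (D : Dataset T H S A) (i : Fin n) (h : Fin H) (s : S i) : ℕ :=
  (Finset.univ.filter fun k : Fin T => (D k h i).1 = s).card

open Classical in
/-- The estimated transition probability `P̂_{i,h}(s' | s, a)`. -/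
def Phat {T : ℕ} (D : Dataset T H S A) (i : Fin n) (h : Fin H) (s : S i) (a : A i)
    (s' : S i) : ℝ :=
  if 1 ≤ countSA D i h s a then (countSAS D i h s a s' : ℝ) / (countSA D i h s a : ℝ)
  else if s' = s then 1 else 0

open Classical in
/-- The estimated averaged reward `r̂_{i,h}(s, a)`. -/
def rhat (M : Game n H S A) {T : ℕ} (D : Dataset T H S A) (i : Fin n) (h : Fin H) (s : S i)
    (a : A i) : ℝ :=
  if 1 ≤ countS D i h s then
    (∑ k : Fin T,
      M.r i h (Function.update (fun j => (D k h j).1) i s)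
          (Function.update (fun j => (D k h j).2) i a)
        * (if (D k h i).1 = s then 1 else 0)) / (countS D i h s : ℝ)
  else 0

/-- The estimated averaged Q-function `Q̂_{i,h}(s, a)`, by backward recursion from the value `0`
after the last step. `DK` is the dataset for the transitions and `D` the one for the rewards. -/
def Qhat (M : Game n H S A) {TK TJ : ℕ} (DK : Dataset TK H S A) (D : Dataset TJ H S A)
    (i : Fin n) (π : AgentPolicy H (S i) (A i)) (h : ℕ) (s : S i) (a : A i) : ℝ :=
  if hh : h < H then
    rhat M D i ⟨h, hh⟩ s a +
      ∑ s' : S i, ∑ a' : A i,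
        Phat DK i ⟨h, hh⟩ s a s' *
          (if hh' : h + 1 < H then (π ⟨h + 1, hh'⟩ s' a').toReal else 0) *
            Qhat M DK D i π (h + 1) s' a'
  else 0
termination_by H - h

/-- A rule that picks the greedy action of agent `i` in round `t`, at step `h`, in the local
state `s`, from the estimated action values. -/
abbrev GreedyRule {n : ℕ} (H : ℕ) (S A : Fin n → Type*) :=
  ∀ i, ℕ → Fin H → S i → (A i → ℝ) → A i

/-- The rule always picks a maximiser (ties are broken in an arbitrary way). -/
def GreedyRule.IsArgmax (g : GreedyRule H S A) : Prop :=
  ∀ i t h s (q : A i → ℝ) (a : A i), q a ≤ q (g i t h s q)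

/-- The soft policy iteration update of round `t`. -/
def updatePolicy (M : Game n H S A) (g : GreedyRule H S A) (t : ℕ) {TK TJ : ℕ}
    (DK : Dataset TK H S A) (D : Dataset TJ H S A) (π : Policy H S A) : Policy H S A :=
  fun i h s =>
    mix (stepSize n H t) (stepSize_nonneg n H t) (stepSize_le_one n H t)
      (π i h s) (PMF.pure (g i t h s fun a => Qhat M DK D i (π i) h s a))

/-- The distribution of `(π^(1), …, π^(T+1))` after `T` rounds that start from `π₁`, given the
dataset `DK`. In each round a fresh dataset of `TJ` trajectories is sampled with the current
policy. -/
def roundsLaw (M : Game n H S A) (g : GreedyRule H S A) (π₁ : Policy H S A) (TJ : ℕ) {TK : ℕ}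
    (DK : Dataset TK H S A) : (T : ℕ) → PMF (Fin (T + 1) → Policy H S A)
  | 0 => PMF.pure fun _ => π₁
  | T + 1 =>
      (roundsLaw M g π₁ TJ DK T).bind fun p =>
        (sampleData M TJ (p (Fin.last T))).bind fun D =>
          PMF.pure (Fin.snoc (α := fun _ => Policy H S A) p
            (updatePolicy M g (T + 1) DK D (p (Fin.last T))))

/-- The distribution of the policies `(π^(1), …, π^(TG+1))` produced by multi-agent soft policy
iteration: first `TK` trajectories under the uniformly random policy, then `TG` rounds with `TJ`
trajectories each. -/
def maspiLaw [∀ i, Nonempty (A i)] (M : Game n H S A) (g : GreedyRule H S A)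
    (π₁ : Policy H S A) (TG TJ TK : ℕ) : PMF (Fin (TG + 1) → Policy H S A) :=
  (sampleData M TK (unifPolicy H S A)).bind fun DK => roundsLaw M g π₁ TJ DK TG

/-- The number of trajectories sampled by `maspiLaw`. -/
def sampleCount (TG TJ TK : ℕ) : ℕ := TG * TJ + TK

/-- `max_i |X i|`. -/
def maxCard {n : ℕ} (X : Fin n → Type*) [∀ i, Fintype (X i)] : ℕ :=
  Finset.univ.sup fun i => Fintype.card (X i)

end Model

/-- The conditions on `TG`, `TJ`, `TK`, where `ΔΦ` stands for `Φ_max - Φ_min`. -/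
structure Thresholds {n : ℕ} (H : ℕ) (S A : Fin n → Type*) [∀ i, Fintype (S i)]
    [∀ i, Fintype (A i)] (c ε δ ΔΦ : ℝ) (TG TJ TK : ℕ) : Prop where
  hTG : 64 * (n : ℝ) ^ 2 * (H : ℝ) ^ 3 *
      ((ΔΦ + 1) / 2 + Real.log (8 * n * (H : ℝ) ^ (3 / 2 : ℝ) * c⁻¹ * ε⁻¹)) ^ 2 /
        (c ^ 2 * ε ^ 2) ≤ (TG : ℝ)
  hTJ : 2048 * (n : ℝ) ^ 2 * (H : ℝ) ^ 4 *
      Real.log (8 * δ⁻¹ * n * H * TG *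
        ∑ i, (Fintype.card (S i) : ℝ) * (Fintype.card (A i) : ℝ)) /
        (c ^ 4 * ε ^ 2) ≤ (TJ : ℝ)
  hTK : 2048 * (n : ℝ) ^ 2 * (maxCard S : ℝ) ^ 2 * (maxCard A : ℝ) ^ 2 * (H : ℝ) ^ 6 *
      Real.log (8 * δ⁻¹ * n * H * TG *
        ∑ i, (Fintype.card (S i) : ℝ) ^ 2 * (Fintype.card (A i) : ℝ)) /
        (c ^ 4 * ε ^ 2) ≤ (TK : ℝ)

end MASPI

end

/-!
Under decoupled dynamics the local trajectories of the agents are independent: at every step the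
global state-action pair is a product of local laws (`map_trajLaw_step`). Hence each agent faces,
against fixed opponents, an ordinary finite-horizon decision process with its own kernels and with
rewards averaged over the others (`J_update`), and the stage potentials add up to a potential of
the whole game (`totalValue_update_sub`).

The performance difference lemma (`J_update_sub`) weighs the advantages of the old policy with the
visiting probabilities of the new one. Exploration bounds these below by `c`, while the gap of the
agent is at most the unweighted sum of the best advantages. So a step of size `η` towards a policy
that is greedy up to `e` improves the value of an agent by at least `η (c * gap - H e)`
(`J_update_mix_sub_ge`). If all agents move at once, the potential changes by the sum of the
separate improvements up to `2 n² H³ η²`, by a total variation estimate of the mixed second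
differences (`totalValue_sub_ge`). With `η_t² = 1 / (4 n² H³ t)` this error is `1 / (2 t)`, and
telescoping the potential over the rounds bounds `∑ NE-Gap / √t` by the potential range plus a
logarithm (`sum_neGap_le_of_softGreedy`); the threshold on the number of rounds absorbs that
logarithm (`potential_term_le`).

The empirical rewards and kernels are ratios of sums of independent bounded variables. By
Hoeffding's inequality and a union bound they are uniformly accurate with high probability
(`rhat_concentration`, `Phat_concentration`); independence of the agents makes the empirical
rewards unbiased given a visit (`expect_rewardDev`). The errors propagate linearly through the
backward recursion (`abs_Qhat_sub_avgQ_le`), so that every round is almost greedy, and a union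
bound over the rounds gives the success probability (`maspiLaw_not_softGreedy_le`).

For the sample complexity the thresholds are rounded up, and all logarithms are bounded by
multiples of `L` (`exists_samples_le`).
-/

namespace MASPI

/-! ### Expectations under finite distributions -/

theorem toReal_apply_mem_unit {α : Type*} (p : PMF α) (x : α) :
    0 ≤ (p x).toReal ∧ (p x).toReal ≤ 1 :=
  ⟨ENNReal.toReal_nonneg,
    ENNReal.toReal_le_of_le_ofReal zero_le_one (by simpa using p.coe_le_one x)⟩

section Expect

variable {α β : Type*} [Fintype α] [Fintype β]

theorem sum_toReal_eq_one (p : PMF α) : ∑ x, (p x).toReal = 1 := by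
  rw [← ENNReal.toReal_sum fun x _ => p.apply_ne_top x, ← tsum_fintype (L := .unconditional _),
    p.tsum_coe, ENNReal.toReal_one]

theorem expect_const (p : PMF α) (k : ℝ) : expect p (fun _ => k) = k := by
  unfold expect
  rw [← Finset.sum_mul, sum_toReal_eq_one, one_mul]

theorem expect_add (p : PMF α) (f g : α → ℝ) :
    expect p (fun x => f x + g x) = expect p f + expect p g := by
  simp [expect, mul_add, Finset.sum_add_distrib]

theorem expect_sub (p : PMF α) (f g : α → ℝ) :
    expect p (fun x => f x - g x) = expect p f - expect p g := by
  simp [expect, mul_sub, Finset.sum_sub_distrib]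

theorem expect_const_mul (p : PMF α) (k : ℝ) (f : α → ℝ) :
    expect p (fun x => k * f x) = k * expect p f := by
  simp only [expect, Finset.mul_sum]
  exact Finset.sum_congr rfl fun x _ => by ring

theorem expect_sum {ι : Type*} (s : Finset ι) (p : PMF α) (f : ι → α → ℝ) :
    expect p (fun x => ∑ i ∈ s, f i x) = ∑ i ∈ s, expect p (f i) := by
  simp only [expect, Finset.mul_sum]
  exact Finset.sum_comm

theorem expect_mono (p : PMF α) {f g : α → ℝ} (h : ∀ x, f x ≤ g x) : expect p f ≤ expect p g :=
  Finset.sum_le_sum fun x _ => mul_le_mul_of_nonneg_left (h x) ENNReal.toReal_nonneg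

theorem expect_nonneg (p : PMF α) {f : α → ℝ} (h : ∀ x, 0 ≤ f x) : 0 ≤ expect p f :=
  Finset.sum_nonneg fun x _ => mul_nonneg ENNReal.toReal_nonneg (h x)

theorem expect_le_const (p : PMF α) {f : α → ℝ} {k : ℝ} (h : ∀ x, f x ≤ k) : expect p f ≤ k :=
  (expect_mono p h).trans_eq (expect_const p k)

theorem const_le_expect (p : PMF α) {f : α → ℝ} {k : ℝ} (h : ∀ x, k ≤ f x) : k ≤ expect p f :=
  (expect_const p k).symm.trans_le (expect_mono p h)

theorem expect_pure (a : α) (f : α → ℝ) : expect (PMF.pure a) f = f a := by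
  classical
  unfold expect
  rw [Finset.sum_eq_single a]
  · simp
  · intro b _ hb
    simp [PMF.pure_apply_of_ne a b hb]
  · simp

theorem expect_bind (p : PMF α) (k : α → PMF β) (f : β → ℝ) :
    expect (p.bind k) f = expect p fun x => expect (k x) f := by
  have hb : ∀ y, (p.bind k y).toReal = ∑ x, (p x).toReal * (k x y).toReal := by
    intro y
    rw [PMF.bind_apply, tsum_fintype, ENNReal.toReal_sum fun x _ =>
      ENNReal.mul_ne_top (p.apply_ne_top x) ((k x).apply_ne_top y)]
    simp [ENNReal.toReal_mul]
  simp only [expect, hb, Finset.sum_mul, Finset.mul_sum]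
  rw [Finset.sum_comm]
  exact Finset.sum_congr rfl fun x _ => Finset.sum_congr rfl fun y _ => by ring

theorem expect_map (p : PMF α) (g : α → β) (f : β → ℝ) :
    expect (p.map g) f = expect p fun x => f (g x) := by
  rw [← PMF.bind_pure_comp, expect_bind]
  simp [expect_pure]

/-- The mass of a point is the expectation of its indicator. -/
theorem expect_ite_eq [DecidableEq α] (p : PMF α) (a : α) :
    expect p (fun x => if x = a then 1 else 0) = (p a).toReal := by
  simp [expect]

theorem toOuterMeasure_le_ofReal_expect (p : PMF α) (s : Set α) (f : α → ℝ)
    (hf : ∀ x, 0 ≤ f x) (hs : ∀ x ∈ s, 1 ≤ f x) :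
    p.toOuterMeasure s ≤ ENNReal.ofReal (expect p f) := by
  classical
  rw [PMF.toOuterMeasure_apply_fintype, expect, ENNReal.ofReal_sum_of_nonneg fun x _ =>
    mul_nonneg ENNReal.toReal_nonneg (hf x)]
  refine Finset.sum_le_sum fun x _ => ?_
  by_cases hx : x ∈ s
  · rw [Set.indicator_of_mem hx, ENNReal.ofReal_mul ENNReal.toReal_nonneg,
      ENNReal.ofReal_toReal (p.apply_ne_top x)]
    exact le_mul_of_one_le_right (zero_le) (ENNReal.one_le_ofReal.mpr (hs x hx))
  · rw [Set.indicator_of_notMem hx]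
    exact zero_le

end Expect

section Mix

variable {α : Type*} [Fintype α]

theorem mix_apply_toReal {η : ℝ} (h0 : 0 ≤ η) (h1 : η ≤ 1) (p q : PMF α) (a : α) :
    (mix η h0 h1 p q a).toReal = (1 - η) * (p a).toReal + η * (q a).toReal := by
  unfold mix
  rw [PMF.ofFintype_apply, ENNReal.toReal_add
    (ENNReal.mul_ne_top ENNReal.ofReal_ne_top (p.apply_ne_top a))
    (ENNReal.mul_ne_top ENNReal.ofReal_ne_top (q.apply_ne_top a)), ENNReal.toReal_mul,
    ENNReal.toReal_mul, ENNReal.toReal_ofReal (by linarith), ENNReal.toReal_ofReal h0]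

theorem expect_mix {η : ℝ} (h0 : 0 ≤ η) (h1 : η ≤ 1) (p q : PMF α) (f : α → ℝ) :
    expect (mix η h0 h1 p q) f = (1 - η) * expect p f + η * expect q f := by
  simp only [expect, mix_apply_toReal, add_mul, Finset.sum_add_distrib, Finset.mul_sum, mul_assoc]

end Mix

/-! ### Product distributions -/

section Prod

variable {ι : Type*} [Fintype ι] [DecidableEq ι] {X Y : ι → Type*} [∀ i, Fintype (X i)]
  [∀ i, Fintype (Y i)]

theorem prodPMF_apply (p : ∀ i, PMF (X i)) (x : ∀ i, X i) : prodPMF p x = ∏ i, p i (x i) := rfl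

/-- The expectation of a product of functions of the single coordinates. -/
theorem expect_prodPMF_prod (p : ∀ i, PMF (X i)) (f : ∀ i, X i → ℝ) :
    expect (prodPMF p) (fun x => ∏ i, f i (x i)) = ∏ i, expect (p i) (f i) := by
  have h := Finset.prod_univ_sum (fun i => (Finset.univ : Finset (X i)))
    (fun i x => (p i x).toReal * f i x)
  rw [Fintype.piFinset_univ] at h
  simp only [expect, prodPMF_apply, ENNReal.toReal_prod, ← Finset.prod_mul_distrib]
  exact h.symm

/-- Independent kernels applied to independent coordinates give independent coordinates. -/
theorem prodPMF_bind (p : ∀ i, PMF (X i)) (k : ∀ i, X i → PMF (Y i)) :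
    ((prodPMF p).bind fun x => prodPMF fun i => k i (x i)) = prodPMF fun i => (p i).bind (k i) := by
  refine PMF.ext fun y => ?_
  simp only [PMF.bind_apply, prodPMF_apply, tsum_fintype, ← Finset.prod_mul_distrib]
  have h := Finset.prod_univ_sum (fun i => (Finset.univ : Finset (X i)))
    (fun i x => p i x * k i x (y i))
  rw [Fintype.piFinset_univ] at h
  exact h.symm

theorem prodPMF_pure (x : ∀ i, X i) : (prodPMF fun i => PMF.pure (x i)) = PMF.pure x := by
  classical
  refine PMF.ext fun y => ?_
  rw [prodPMF_apply]
  by_cases h : y = x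
  · subst h
    simp
  · obtain ⟨i, hi⟩ := Function.ne_iff.mp h
    rw [PMF.pure_apply_of_ne x y h]
    exact Finset.prod_eq_zero (Finset.mem_univ i) (PMF.pure_apply_of_ne _ _ hi)

theorem prodPMF_map (p : ∀ i, PMF (X i)) (f : ∀ i, X i → Y i) :
    (prodPMF p).map (fun x i => f i (x i)) = prodPMF fun i => (p i).map (f i) := by
  have h := prodPMF_bind p fun i x => PMF.pure (f i x)
  simp only [prodPMF_pure] at h
  exact h

/-- The expectation under a product distribution with coordinate `i` separated from the rest. -/
theorem expect_prodPMF_split (p : ∀ i, PMF (X i)) (i : ι) (f : (∀ i, X i) → ℝ) :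
    expect (prodPMF p) f = ∑ x : X i, ∑ y : ∀ j : {j // j ≠ i}, X j,
      (p i x).toReal * (∏ j : {j // j ≠ i}, (p j (y j)).toReal) *
        f ((Equiv.piSplitAt i X).symm (x, y)) := by
  rw [expect, ← (Equiv.piSplitAt i X).symm.sum_comp, Fintype.sum_prod_type]
  refine Finset.sum_congr rfl fun x _ => Finset.sum_congr rfl fun y _ => ?_
  congr 1
  rw [prodPMF_apply, ENNReal.toReal_prod, Fintype.prod_eq_mul_prod_subtype_ne _ i]
  congr 1
  · simp [Equiv.piSplitAt]
  · refine Finset.prod_congr rfl fun j _ => ?_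
    simp [Equiv.piSplitAt, j.2]

/-- Fubini's theorem for one coordinate, in a form that also replaces its distribution: the inner
expectation is over all coordinates, with coordinate `i` overwritten. -/
theorem expect_prodPMF_update (p : ∀ i, PMF (X i)) (i : ι) (q : PMF (X i))
    (f : (∀ i, X i) → ℝ) :
    expect (prodPMF (Function.update p i q)) f =
      expect q fun x => expect (prodPMF p) fun y => f (Function.update y i x) := by
  have hu : ∀ (x x' : X i) (y : ∀ j : {j // j ≠ i}, X j),
      Function.update ((Equiv.piSplitAt i X).symm (x', y)) i x
        = (Equiv.piSplitAt i X).symm (x, y) := by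
    intro x x' y
    funext j
    by_cases hj : j = i
    · subst hj
      simp [Equiv.piSplitAt]
    · simp [Equiv.piSplitAt, hj]
  rw [expect_prodPMF_split _ i]
  conv_rhs => rw [expect]
  refine Finset.sum_congr rfl fun x _ => ?_
  rw [expect_prodPMF_split _ i]
  simp only [hu, mul_assoc, ← Finset.mul_sum]
  rw [← Finset.sum_mul, sum_toReal_eq_one, one_mul, Function.update_self]
  congr 1
  refine Finset.sum_congr rfl fun y _ => ?_
  congr 1
  exact Finset.prod_congr rfl fun j _ => by rw [Function.update_of_ne j.2]

theorem expect_prodPMF_fubini (p : ∀ i, PMF (X i)) (i : ι) (f : (∀ i, X i) → ℝ) :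
    expect (prodPMF p) f =
      expect (p i) fun x => expect (prodPMF p) fun y => f (Function.update y i x) := by
  rw [← expect_prodPMF_update, Function.update_eq_self]

theorem expect_prodPMF_coord (p : ∀ i, PMF (X i)) (i : ι) (f : X i → ℝ) :
    expect (prodPMF p) (fun x => f (x i)) = expect (p i) f := by
  rw [expect_prodPMF_fubini p i]
  simp [expect_const]

end Prod

/-! ### Marginals of the trajectory distribution -/

section Laws

variable {n H : ℕ} {S A : Fin n → Type*}

/-- The distribution of the local state of agent `i` at step `m` under its policy `σ`. Because the
dynamics are decoupled, it does not depend on the policies of the other agents. -/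
noncomputable def stateLaw (M : Game n H S A) (i : Fin n) (σ : AgentPolicy H (S i) (A i)) :
    (m : ℕ) → m < H → PMF (S i)
  | 0, _ => M.ρ i
  | m + 1, hm =>
      (stateLaw M i σ m (Nat.lt_of_succ_lt hm)).bind fun s =>
        (σ ⟨m, Nat.lt_of_succ_lt hm⟩ s).bind fun a => M.P i ⟨m, Nat.lt_of_succ_lt hm⟩ s a

/-- The joint distribution of the local state and action of agent `i` at step `h`. -/
noncomputable def saLaw (M : Game n H S A) (i : Fin n) (σ : AgentPolicy H (S i) (A i))
    (h : Fin H) : PMF (S i × A i) :=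
  (stateLaw M i σ h h.2).bind fun s => (σ h s).map (Prod.mk s)

theorem stateLaw_succ (M : Game n H S A) (i : Fin n) (σ : AgentPolicy H (S i) (A i)) (m : ℕ)
    (hm : m + 1 < H) :
    stateLaw M i σ (m + 1) hm = (saLaw M i σ ⟨m, Nat.lt_of_succ_lt hm⟩).bind fun x =>
      M.P i ⟨m, Nat.lt_of_succ_lt hm⟩ x.1 x.2 := by
  simp only [saLaw, stateLaw, PMF.bind_bind, PMF.bind_map, Function.comp_def]

variable [∀ i, Fintype (S i)] [∀ i, Fintype (A i)]

theorem expect_saLaw (M : Game n H S A) (i : Fin n) (σ : AgentPolicy H (S i) (A i))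
    (h : Fin H) (f : S i × A i → ℝ) :
    expect (saLaw M i σ h) f =
      expect (stateLaw M i σ h h.2) fun s => expect (σ h s) fun a => f (s, a) := by
  simp only [saLaw, expect_bind, expect_map]

/-- The global state-action pair of one step, given the global state of that step. -/
theorem bind_action_prodPMF (π : Policy H S A) (h : Fin H) (p : ∀ i, PMF (S i)) :
    ((prodPMF p).bind fun s => (prodPMF fun i => π i h (s i)).bind fun a =>
        PMF.pure fun i => (s i, a i))
      = prodPMF fun i => (p i).bind fun s => (π i h s).map (Prod.mk s) := by
  rw [← prodPMF_bind]
  congr 1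
  funext s
  exact prodPMF_map (fun i => π i h (s i)) fun i => Prod.mk (s i)

/-- The last state-action pair of a trajectory has independent coordinates: the kernels and the
policies act on every agent separately. -/
theorem map_last_trajLawAux (M : Game n H S A) (π : Policy H S A) (m : ℕ) (hm : m + 1 ≤ H) :
    (trajLawAux M π (m + 1) hm).map (fun τ => τ (Fin.last m))
      = prodPMF fun i => saLaw M i (π i) ⟨m, hm⟩ := by
  induction m with
  | zero =>
    simp only [trajLawAux, PMF.map_bind, PMF.pure_map, Fin.snoc_last, PMF.pure_bind, nextState]
    rw [bind_action_prodPMF]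
    rfl
  | succ m ih =>
    rw [trajLawAux.eq_2 M π (m + 1)]
    simp only [PMF.map_bind, PMF.pure_map, Fin.snoc_last, nextState]
    refine (PMF.bind_map (trajLawAux M π (m + 1) (Nat.le_of_succ_le hm))
      (fun τ => τ (Fin.last m))
      (fun x => (prodPMF fun i => M.P i ⟨m, Nat.lt_of_succ_lt hm⟩ (x i).1 (x i).2).bind fun s =>
        (prodPMF fun i => π i ⟨m + 1, hm⟩ (s i)).bind fun a =>
          PMF.pure fun i => (s i, a i))).symm.trans ?_
    rw [ih, ← PMF.bind_bind, prodPMF_bind _ fun i (x : S i × A i) =>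
        M.P i ⟨m, Nat.lt_of_succ_lt hm⟩ x.1 x.2, bind_action_prodPMF]
    congr 1
    funext i
    exact congrArg (fun q => q.bind fun s => (π i ⟨m + 1, hm⟩ s).map (Prod.mk s))
      (stateLaw_succ M i (π i) m hm).symm

/-- The events of the first `m` steps do not depend on the later ones. -/
theorem map_init_trajLawAux (M : Game n H S A) (π : Policy H S A) (m : ℕ) (hm : m + 1 ≤ H) :
    (trajLawAux M π (m + 1) hm).map (fun τ (k : Fin m) => τ k.castSucc)
      = trajLawAux M π m (Nat.le_of_succ_le hm) := by
  simp only [trajLawAux, PMF.map_bind, PMF.pure_map, Fin.snoc_castSucc, PMF.bind_const]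
  exact PMF.bind_pure _

theorem map_castLE_trajLawAux (M : Game n H S A) (π : Policy H S A) (m k : ℕ) (hk : m + k ≤ H) :
    (trajLawAux M π (m + k) hk).map (fun τ (j : Fin m) => τ (Fin.castLE (Nat.le_add_right m k) j))
      = trajLawAux M π m ((Nat.le_add_right m k).trans hk) := by
  induction k with
  | zero => exact PMF.map_id _
  | succ k ih =>
    rw [← ih (Nat.le_of_succ_le hk), ← map_init_trajLawAux M π (m + k) hk, PMF.map_comp]
    rfl

theorem map_trajLaw_castLE (M : Game n H S A) (π : Policy H S A) (m : ℕ) (hm : m ≤ H) :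
    (trajLaw M π).map (fun τ (j : Fin m) => τ (Fin.castLE hm j)) = trajLawAux M π m hm := by
  obtain ⟨k, rfl⟩ := Nat.exists_eq_add_of_le hm
  exact map_castLE_trajLawAux M π m k le_rfl

/-- At every step the local state-action pairs of the agents are independent. -/
theorem map_trajLaw_step (M : Game n H S A) (π : Policy H S A) (h : Fin H) :
    (trajLaw M π).map (fun τ => τ h) = prodPMF fun i => saLaw M i (π i) h := by
  rw [← map_last_trajLawAux M π h h.2, ← map_trajLaw_castLE M π (h + 1) h.2, PMF.map_comp]
  rfl

theorem expect_trajLaw_step (M : Game n H S A) (π : Policy H S A) (h : Fin H)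
    (f : (∀ i, S i × A i) → ℝ) :
    expect (trajLaw M π) (fun τ => f (τ h)) = expect (prodPMF fun i => saLaw M i (π i) h) f := by
  rw [← map_trajLaw_step, expect_map]

theorem expect_trajLaw_local (M : Game n H S A) (π : Policy H S A) (h : Fin H) (i : Fin n)
    (f : S i × A i → ℝ) :
    expect (trajLaw M π) (fun τ => f (τ h i)) = expect (saLaw M i (π i) h) f := by
  rw [expect_trajLaw_step M π h fun x => f (x i), expect_prodPMF_coord]

/-- The local transitions of agent `i` along a trajectory. -/
theorem expect_trajLaw_transition (M : Game n H S A) (π : Policy H S A) (h : ℕ) (hh : h + 1 < H)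
    (i : Fin n) (f : S i × A i → S i → ℝ) :
    expect (trajLaw M π)
        (fun τ => f (τ ⟨h, Nat.lt_of_succ_lt hh⟩ i) (τ ⟨h + 1, hh⟩ i).1)
      = expect (saLaw M i (π i) ⟨h, Nat.lt_of_succ_lt hh⟩) fun x =>
          expect (M.P i ⟨h, Nat.lt_of_succ_lt hh⟩ x.1 x.2) (f x) := by
  have h1 : expect (trajLaw M π)
        (fun τ => f (τ ⟨h, Nat.lt_of_succ_lt hh⟩ i) (τ ⟨h + 1, hh⟩ i).1)
      = expect (trajLawAux M π (h + 1 + 1) hh)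
        fun τ => f (τ (Fin.last h).castSucc i) (τ (Fin.last (h + 1)) i).1 := by
    rw [← map_trajLaw_castLE M π (h + 1 + 1) hh, expect_map]
    rfl
  rw [h1]
  simp only [trajLawAux.eq_2 (m := h + 1), expect_bind, expect_pure, Fin.snoc_last,
    Fin.snoc_castSucc, expect_const, nextState]
  have h2 := fun τ : Traj (h + 1) S A => expect_prodPMF_coord
    (fun i => M.P i ⟨h, Nat.lt_of_succ_lt hh⟩ (τ (Fin.last h) i).1 (τ (Fin.last h) i).2) i
    (f (τ (Fin.last h) i))
  simp only [h2]
  have h3 := map_last_trajLawAux M π h (Nat.le_of_succ_le hh)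
  rw [← expect_prodPMF_coord (fun i => saLaw M i (π i) ⟨h, Nat.lt_of_succ_lt hh⟩) i
    fun x => expect (M.P i ⟨h, Nat.lt_of_succ_lt hh⟩ x.1 x.2) (f x), ← h3, expect_map]

theorem visitProb_eq (M : Game n H S A) (π : Policy H S A) (i : Fin n) (h : Fin H) (s : S i) :
    visitProb M π i h s = (stateLaw M i (π i) h h.2 s).toReal := by
  classical
  unfold visitProb
  rw [expect_trajLaw_local M π h i fun x => if x.1 = s then 1 else 0, expect_saLaw]
  rw [← expect_ite_eq (stateLaw M i (π i) h h.2) s]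
  congr 1
  funext s'
  simpa using expect_const (π i h s') (if s' = s then 1 else 0)

theorem totalValue_eq (M : Game n H S A) (f : Fin H → (∀ i, S i) → (∀ i, A i) → ℝ)
    (π : Policy H S A) :
    totalValue M f π = ∑ h, expect (prodPMF fun i => saLaw M i (π i) h)
      fun x => f h (fun i => (x i).1) fun i => (x i).2 := by
  unfold totalValue
  rw [expect_sum]
  exact Finset.sum_congr rfl fun h _ =>
    expect_trajLaw_step M π h fun x => f h (fun i => (x i).1) fun i => (x i).2

end Laws

/-! ### The averaged decision process of one agent -/

section Values

variable {H : ℕ} {X Y : Type*} [Fintype X] [Fintype Y]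

/-- The action value at step `h` (`0` from step `H` on) of the policy `σ` in a finite-horizon
decision process with the kernels `P` and the rewards `R`, by backward recursion. -/
noncomputable def qValue (P : Fin H → X → Y → PMF X) (R : Fin H → X → Y → ℝ)
    (σ : AgentPolicy H X Y) (h : ℕ) (s : X) (a : Y) : ℝ :=
  if hh : h < H then
    R ⟨h, hh⟩ s a + expect (P ⟨h, hh⟩ s a) fun s' =>
      if hh' : h + 1 < H then expect (σ ⟨h + 1, hh'⟩ s') (qValue P R σ (h + 1) s') else 0
  else 0
termination_by H - h

/-- The state value at step `h` (`0` from step `H` on). -/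
noncomputable def sValue (P : Fin H → X → Y → PMF X) (R : Fin H → X → Y → ℝ)
    (σ : AgentPolicy H X Y) (h : ℕ) (s : X) : ℝ :=
  if hh : h < H then expect (σ ⟨h, hh⟩ s) (qValue P R σ h s) else 0

variable (P : Fin H → X → Y → PMF X) (R : Fin H → X → Y → ℝ) (σ : AgentPolicy H X Y)

theorem qValue_eq (h : Fin H) (s : X) (a : Y) :
    qValue P R σ h s a = R h s a + expect (P h s a) (sValue P R σ (h + 1)) := by
  rw [qValue, dif_pos h.2]
  rfl

theorem sValue_eq (h : Fin H) (s : X) :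
    sValue P R σ h s = expect (σ h s) (qValue P R σ h s) := by
  rw [sValue, dif_pos h.2]

theorem qValue_bounds (hR : ∀ h s a, 0 ≤ R h s a ∧ R h s a ≤ 1) (h : ℕ) (s : X) (a : Y) :
    0 ≤ qValue P R σ h s a ∧ qValue P R σ h s a ≤ (H - h : ℕ) := by
  induction hk : H - h generalizing h s a with
  | zero =>
    rw [qValue, dif_neg (by omega)]
    simp
  | succ k ih =>
    have hh : h < H := by omega
    have hV : ∀ s', 0 ≤ sValue P R σ (h + 1) s' ∧ sValue P R σ (h + 1) s' ≤ k := by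
      intro s'
      unfold sValue
      split_ifs with h1
      · exact ⟨expect_nonneg _ fun a' => (ih (h + 1) s' a' (by omega)).1,
          expect_le_const _ fun a' => (ih (h + 1) s' a' (by omega)).2⟩
      · simp
    have hq := qValue_eq P R σ ⟨h, hh⟩ s a
    have h1 := expect_nonneg (P ⟨h, hh⟩ s a) fun s' => (hV s').1
    have h2 := expect_le_const (P ⟨h, hh⟩ s a) fun s' => (hV s').2
    have h3 := hR ⟨h, hh⟩ s a
    simp only at hq
    push_cast
    constructor <;> linarith

theorem sValue_bounds (hR : ∀ h s a, 0 ≤ R h s a ∧ R h s a ≤ 1) (h : ℕ) (s : X) :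
    0 ≤ sValue P R σ h s ∧ sValue P R σ h s ≤ H := by
  unfold sValue
  split_ifs with h1
  · refine ⟨expect_nonneg _ fun a => (qValue_bounds P R σ hR h s a).1,
      expect_le_const _ fun a => (qValue_bounds P R σ hR h s a).2.trans ?_⟩
    exact_mod_cast Nat.sub_le H h
  · simp

end Values

section Agent

variable {n H : ℕ} {S A : Fin n → Type*}

theorem update_pair_fst (y : ∀ j, S j × A j) (i : Fin n) (x : S i × A i) :
    (fun j => (Function.update y i x j).1) = Function.update (fun j => (y j).1) i x.1 := by
  funext j
  by_cases hj : j = i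
  · subst hj; simp
  · simp [hj]

theorem update_pair_snd (y : ∀ j, S j × A j) (i : Fin n) (x : S i × A i) :
    (fun j => (Function.update y i x j).2) = Function.update (fun j => (y j).2) i x.2 := by
  funext j
  by_cases hj : j = i
  · subst hj; simp
  · simp [hj]

theorem saLaw_update (M : Game n H S A) (π : Policy H S A) (i : Fin n)
    (σ : AgentPolicy H (S i) (A i)) (h : Fin H) :
    (fun j => saLaw M j (Function.update π i σ j) h)
      = Function.update (fun j => saLaw M j (π j) h) i (saLaw M i σ h) := by
  funext j
  by_cases hj : j = i
  · subst hj; simp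
  · simp [hj]

variable [∀ i, Fintype (S i)] [∀ i, Fintype (A i)]

/-- The reward `r_{i,h}(s, a)` averaged over the local states and actions that the other agents
have at step `h` under `π`. -/
noncomputable def rbar (M : Game n H S A) (π : Policy H S A) (i : Fin n) (h : Fin H) (s : S i)
    (a : A i) : ℝ :=
  expect (prodPMF fun j => saLaw M j (π j) h) fun y =>
    M.r i h (Function.update (fun j => (y j).1) i s) (Function.update (fun j => (y j).2) i a)

theorem rbar_bounds (M : Game n H S A) (π : Policy H S A) (i : Fin n) (h : Fin H) (s : S i)
    (a : A i) : 0 ≤ rbar M π i h s a ∧ rbar M π i h s a ≤ 1 :=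
  ⟨expect_nonneg _ fun _ => M.r_nonneg _ _ _ _, expect_le_const _ fun _ => M.r_le_one _ _ _ _⟩

/-- Against fixed opponents, the total of a stage function is linear in the local state-action
distributions of agent `i`. -/
theorem totalValue_update (M : Game n H S A) (f : Fin H → (∀ i, S i) → (∀ i, A i) → ℝ)
    (π : Policy H S A) (i : Fin n) (σ : AgentPolicy H (S i) (A i)) :
    totalValue M f (Function.update π i σ) = ∑ h, expect (saLaw M i σ h) fun x =>
      expect (prodPMF fun j => saLaw M j (π j) h) fun y =>
        f h (Function.update (fun j => (y j).1) i x.1)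
          (Function.update (fun j => (y j).2) i x.2) := by
  rw [totalValue_eq]
  refine Finset.sum_congr rfl fun h _ => ?_
  rw [saLaw_update, expect_prodPMF_update]
  simp only [update_pair_fst, update_pair_snd]

theorem J_update (M : Game n H S A) (π : Policy H S A) (i : Fin n)
    (σ : AgentPolicy H (S i) (A i)) :
    J M i (Function.update π i σ) =
      ∑ h, expect (saLaw M i σ h) fun x => rbar M π i h x.1 x.2 :=
  totalValue_update M (M.r i) π i σ

/-- The averaged action value `Q_{i,h}` of agent `i` under the joint policy `π`. -/
noncomputable def avgQ (M : Game n H S A) (π : Policy H S A) (i : Fin n) (h : ℕ) (s : S i)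
    (a : A i) : ℝ :=
  qValue (M.P i) (rbar M π i) (π i) h s a

/-- The averaged state value `V_{i,h}` of agent `i` under the joint policy `π`. -/
noncomputable def avgV (M : Game n H S A) (π : Policy H S A) (i : Fin n) (h : ℕ) (s : S i) : ℝ :=
  sValue (M.P i) (rbar M π i) (π i) h s

theorem avgV_eq (M : Game n H S A) (π : Policy H S A) (i : Fin n) (h : Fin H) (s : S i) :
    avgV M π i h s = expect (π i h s) (avgQ M π i h s) := sValue_eq _ _ _ h s

theorem avgQ_eq (M : Game n H S A) (π : Policy H S A) (i : Fin n) (h : Fin H) (s : S i)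
    (a : A i) :
    avgQ M π i h s a = rbar M π i h s a + expect (M.P i h s a) (avgV M π i (h + 1)) :=
  qValue_eq _ _ _ h s a

/-- The value of `σ`, expanded along the action values of `π i`. The first term does not depend
on `σ`, which makes this the performance difference lemma. -/
theorem J_update_expand (hH : 0 < H) (M : Game n H S A) (π : Policy H S A) (i : Fin n)
    (σ : AgentPolicy H (S i) (A i)) :
    J M i (Function.update π i σ) = expect (M.ρ i) (avgV M π i 0) +
      ∑ h : Fin H, expect (stateLaw M i σ h h.2) fun s =>
        expect (σ h s) (avgQ M π i h s) - avgV M π i h s := by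
  rw [J_update]
  -- `W m` is the expected value-to-go, under `π i`, of the state that `σ` reaches at step `m`.
  set W : ℕ → ℝ := fun m =>
    if hm : m < H then expect (stateLaw M i σ m hm) (avgV M π i m) else 0 with hW
  have hterm : ∀ h : Fin H, expect (saLaw M i σ h) (fun x => rbar M π i h x.1 x.2)
      = (expect (stateLaw M i σ h h.2) fun s =>
        expect (σ h s) (avgQ M π i h s) - avgV M π i h s) - (W (h + 1) - W h) := by
    intro h
    have hWh : W h = expect (stateLaw M i σ h h.2) (avgV M π i h) := dif_pos h.2
    have hWs : W (h + 1) = expect (saLaw M i σ h) fun x =>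
        expect (M.P i h x.1 x.2) (avgV M π i (h + 1)) := by
      by_cases hm : (h : ℕ) + 1 < H
      · simp only [hW, dif_pos hm, stateLaw_succ, expect_bind]
      · have hV : avgV M π i ((h : ℕ) + 1) = fun _ => 0 := by
          funext s
          rw [avgV, sValue, dif_neg hm]
        simp only [hW, dif_neg hm, hV, expect_const]
    rw [expect_sub, ← hWh, hWs, expect_saLaw, expect_saLaw]
    have hQ : ∀ s, avgQ M π i h s = fun a =>
        rbar M π i h s a + expect (M.P i h s a) (avgV M π i (h + 1)) :=
      fun s => funext (avgQ_eq M π i h s)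
    simp only [hQ, expect_add]
    ring
  rw [Finset.sum_congr rfl fun h _ => hterm h, Finset.sum_sub_distrib,
    Fin.sum_univ_eq_sum_range (fun m => W (m + 1) - W m) H, Finset.sum_range_sub]
  have h0 : W 0 = expect (M.ρ i) (avgV M π i 0) := dif_pos hH
  have h1 : W H = 0 := dif_neg (lt_irrefl H)
  rw [h0, h1]
  ring

theorem J_eq_expect_avgV (hH : 0 < H) (M : Game n H S A) (π : Policy H S A) (i : Fin n) :
    J M i π = expect (M.ρ i) (avgV M π i 0) := by
  have h := J_update_expand hH M π i (π i)
  rw [Function.update_eq_self] at h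
  simpa [avgV_eq, expect_const] using h

/-- The performance difference lemma. -/
theorem J_update_sub (hH : 0 < H) (M : Game n H S A) (π : Policy H S A) (i : Fin n)
    (σ : AgentPolicy H (S i) (A i)) :
    J M i (Function.update π i σ) - J M i π =
      ∑ h : Fin H, expect (stateLaw M i σ h h.2) fun s =>
        expect (σ h s) (avgQ M π i h s) - avgV M π i h s := by
  rw [J_update_expand hH, J_eq_expect_avgV hH]
  ring

/-- The advantage of the best action in state `s` over the policy `π i`. -/
noncomputable def bestAdv (M : Game n H S A) (π : Policy H S A) (i : Fin n) (h : Fin H)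
    (s : S i) : ℝ :=
  (⨆ a, avgQ M π i h s a) - avgV M π i h s

theorem avgQ_sub_avgV_le_bestAdv (M : Game n H S A) (π : Policy H S A) (i : Fin n) (h : Fin H)
    (s : S i) (p : PMF (A i)) :
    expect p (avgQ M π i h s) - avgV M π i h s ≤ bestAdv M π i h s :=
  sub_le_sub_right (expect_le_const p fun a => le_ciSup (Set.finite_range _).bddAbove a) _

theorem bestAdv_nonneg (M : Game n H S A) (π : Policy H S A) (i : Fin n) (h : Fin H)
    (s : S i) : 0 ≤ bestAdv M π i h s := by
  have h1 := avgQ_sub_avgV_le_bestAdv M π i h s (π i h s)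
  rwa [← avgV_eq, sub_self] at h1

theorem expect_le_sum {α : Type*} [Fintype α] (p : PMF α) {f : α → ℝ} (hf : ∀ x, 0 ≤ f x) :
    expect p f ≤ ∑ x, f x :=
  Finset.sum_le_sum fun x _ => mul_le_of_le_one_left (hf x) (toReal_apply_mem_unit p x).2

/-- The performance difference lemma with all visiting probabilities bounded by `1`. -/
theorem agentGap_le [∀ i, Nonempty (A i)] (hH : 0 < H) (M : Game n H S A) (π : Policy H S A)
    (i : Fin n) : agentGap M i π ≤ ∑ h : Fin H, ∑ s, bestAdv M π i h s := by
  unfold agentGap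
  rw [sub_le_iff_le_add]
  have : Nonempty (AgentPolicy H (S i) (A i)) := ⟨fun _ _ => PMF.uniformOfFintype (A i)⟩
  refine ciSup_le fun σ => ?_
  rw [← sub_le_iff_le_add, J_update_sub hH]
  refine Finset.sum_le_sum fun h _ => ?_
  exact (expect_mono _ fun s => avgQ_sub_avgV_le_bestAdv M π i h s (σ h s)).trans
    (expect_le_sum _ fun s => bestAdv_nonneg M π i h s)

/-- A step of size `η` towards an almost greedy policy improves the value of agent `i` by almost
`η c` times its gap. The weights in the performance difference lemma are the visiting probabilities
of the new policy; exploration bounds them below by `c`. -/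
theorem J_update_mix_sub_ge [∀ i, Nonempty (A i)] (hH : 0 < H) (M : Game n H S A) {c : ℝ}
    (hc : SufficientExploration M c)
    (π : Policy H S A) (i : Fin n) {η : ℝ} (h0 : 0 ≤ η) (h1 : η ≤ 1)
    (σ : AgentPolicy H (S i) (A i)) (b : Fin H → S i → A i)
    (hσ : ∀ h s, σ h s = mix η h0 h1 (π i h s) (PMF.pure (b h s))) {e : ℝ}
    (hb : ∀ (h : Fin H) s a, avgQ M π i h s a ≤ avgQ M π i h s (b h s) + e) :
    η * (c * agentGap M i π - H * e) ≤ J M i (Function.update π i σ) - J M i π := by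
  rw [J_update_sub hH]
  have hstep : ∀ h : Fin H, η * (c * ∑ s, bestAdv M π i h s - e) ≤
      expect (stateLaw M i σ h h.2) fun s =>
        expect (σ h s) (avgQ M π i h s) - avgV M π i h s := by
    intro h
    have hpt : ∀ s, η * (bestAdv M π i h s - e) ≤
        expect (σ h s) (avgQ M π i h s) - avgV M π i h s := by
      intro s
      rw [hσ, expect_mix, expect_pure, ← avgV_eq]
      have hsup : (⨆ a, avgQ M π i h s a) ≤ avgQ M π i h s (b h s) + e := ciSup_le (hb h s)
      have : bestAdv M π i h s - e ≤ avgQ M π i h s (b h s) - avgV M π i h s := by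
        unfold bestAdv; linarith
      nlinarith [mul_le_mul_of_nonneg_left this h0]
    refine le_trans ?_ (expect_mono _ hpt)
    rw [expect_const_mul, expect_sub, expect_const]
    refine mul_le_mul_of_nonneg_left (sub_le_sub_right ?_ _) h0
    rw [Finset.mul_sum]
    refine Finset.sum_le_sum fun s _ => mul_le_mul_of_nonneg_right ?_ (bestAdv_nonneg _ _ _ _ _)
    have hv := (hc.2 (Function.update π i σ) i h s).le
    rwa [visitProb_eq, Function.update_self] at hv
  refine le_trans ?_ (Finset.sum_le_sum fun h _ => hstep h)
  rw [← Finset.mul_sum, Finset.sum_sub_distrib, ← Finset.mul_sum, Finset.sum_const,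
    Finset.card_univ, Fintype.card_fin, nsmul_eq_mul]
  exact mul_le_mul_of_nonneg_left (sub_le_sub_right
    (mul_le_mul_of_nonneg_left (agentGap_le hH M π i) hc.1.le) _) h0

end Agent

/-! ### Total variation distance -/

section TV

variable {α β : Type*} [Fintype α] [Fintype β]

/-- The total variation distance of two distributions on a finite type. -/
noncomputable def tv (p q : PMF α) : ℝ := (∑ x, |(p x).toReal - (q x).toReal|) / 2

theorem tv_self (p : PMF α) : tv p p = 0 := by simp [tv]

theorem tv_le_one (p q : PMF α) : tv p q ≤ 1 := by
  have h : ∑ x, |(p x).toReal - (q x).toReal| ≤ ∑ x, ((p x).toReal + (q x).toReal) :=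
    Finset.sum_le_sum fun x _ => (abs_sub _ _).trans_eq (by
      rw [abs_of_nonneg ENNReal.toReal_nonneg, abs_of_nonneg ENNReal.toReal_nonneg])
  rw [Finset.sum_add_distrib, sum_toReal_eq_one, sum_toReal_eq_one] at h
  unfold tv
  linarith

/-- Only the deviation of `f` from an arbitrary constant `m` matters. -/
theorem abs_expect_sub_le_tv (p q : PMF α) {f : α → ℝ} (m : ℝ) {k : ℝ}
    (hf : ∀ x, |f x - m| ≤ k) : |expect p f - expect q f| ≤ 2 * k * tv p q := by
  have h : expect p f - expect q f = ∑ x, ((p x).toReal - (q x).toReal) * (f x - m) := by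
    simp only [sub_mul, mul_sub, Finset.sum_sub_distrib, ← Finset.sum_mul, sum_toReal_eq_one]
    simp only [expect]
    ring
  rw [h]
  refine (Finset.abs_sum_le_sum_abs _ _).trans ?_
  have h2 : 2 * k * tv p q = ∑ x, |(p x).toReal - (q x).toReal| * k := by
    rw [← Finset.sum_mul]; unfold tv; ring
  rw [h2]
  refine Finset.sum_le_sum fun x _ => ?_
  rw [abs_mul]
  exact mul_le_mul_of_nonneg_left (hf x) (abs_nonneg _)

theorem abs_expect_sub_le_tv_of_mem_unit (p q : PMF α) {f : α → ℝ}
    (hf : ∀ x, 0 ≤ f x ∧ f x ≤ 1) : |expect p f - expect q f| ≤ tv p q := by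
  have h := abs_expect_sub_le_tv p q (f := f) (1 / 2) (k := 1 / 2) fun x =>
    abs_le.mpr ⟨by linarith [(hf x).1], by linarith [(hf x).2]⟩
  linarith

theorem tv_bind_le (p q : PMF α) (f g : α → PMF β) {b : ℝ} (hb : ∀ x, tv (f x) (g x) ≤ b) :
    tv (p.bind f) (q.bind g) ≤ tv p q + b := by
  classical
  have hbind : ∀ (p : PMF α) (f : α → PMF β) y,
      (p.bind f y).toReal = ∑ x, (p x).toReal * (f x y).toReal := fun p f y => by
    rw [← expect_ite_eq, expect_bind]
    simp only [expect_ite_eq]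
    rfl
  have h1 : ∀ y, |(p.bind f y).toReal - (q.bind g y).toReal| ≤
      ∑ x, (|(p x).toReal - (q x).toReal| * (f x y).toReal +
        (q x).toReal * |(f x y).toReal - (g x y).toReal|) := by
    intro y
    rw [hbind, hbind, ← Finset.sum_sub_distrib]
    refine (Finset.abs_sum_le_sum_abs _ _).trans (Finset.sum_le_sum fun x _ => ?_)
    have h2 : (p x).toReal * (f x y).toReal - (q x).toReal * (g x y).toReal
        = ((p x).toReal - (q x).toReal) * (f x y).toReal +
          (q x).toReal * ((f x y).toReal - (g x y).toReal) := by ring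
    rw [h2]
    refine (abs_add_le _ _).trans_eq ?_
    rw [abs_mul, abs_mul, abs_of_nonneg (a := (f x y).toReal) ENNReal.toReal_nonneg,
      abs_of_nonneg (a := (q x).toReal) ENNReal.toReal_nonneg]
  have h3 := Finset.sum_le_sum fun y (_ : y ∈ (Finset.univ : Finset β)) => h1 y
  rw [Finset.sum_comm] at h3
  simp only [Finset.sum_add_distrib, ← Finset.mul_sum, sum_toReal_eq_one, mul_one] at h3
  have h4 : ∑ x, (q x).toReal * ∑ y, |(f x y).toReal - (g x y).toReal| ≤ 2 * b := by
    refine expect_le_const q fun x => ?_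
    have := hb x
    unfold tv at this
    linarith
  unfold tv
  linarith

theorem tv_map_le (p q : PMF α) (f : α → β) : tv (p.map f) (q.map f) ≤ tv p q := by
  have h := tv_bind_le p q (PMF.pure ∘ f) (PMF.pure ∘ f) (b := 0) fun x => (tv_self _).le
  rwa [add_zero] at h

theorem tv_mix_left_le {η : ℝ} (h0 : 0 ≤ η) (h1 : η ≤ 1) (p q : PMF α) :
    tv (mix η h0 h1 p q) p ≤ η := by
  have h : tv (mix η h0 h1 p q) p = η * tv q p := by
    unfold tv
    rw [← mul_div_assoc, Finset.mul_sum]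
    congr 1
    refine Finset.sum_congr rfl fun x _ => ?_
    rw [mix_apply_toReal, ← abs_of_nonneg h0, ← abs_mul, abs_of_nonneg h0]
    congr 1
    ring
  rw [h]
  exact mul_le_of_le_one_right h0 (tv_le_one q p)

/-- Replacing the coordinates one at a time. -/
theorem abs_expect_prodPMF_sub_le {ι : Type*} [Fintype ι] [DecidableEq ι] {X : ι → Type*}
    [∀ i, Fintype (X i)] (p q : ∀ i, PMF (X i)) {f : (∀ i, X i) → ℝ}
    (hf : ∀ x, 0 ≤ f x ∧ f x ≤ 1) :
    |expect (prodPMF q) f - expect (prodPMF p) f| ≤ ∑ i, tv (q i) (p i) := by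
  have key : ∀ s : Finset ι,
      |expect (prodPMF (s.piecewise q p)) f - expect (prodPMF p) f| ≤ ∑ i ∈ s, tv (q i) (p i) := by
    intro s
    induction s using Finset.induction_on with
    | empty => simp
    | insert j s hj ih =>
      rw [Finset.piecewise_insert, expect_prodPMF_update, Finset.sum_insert hj]
      have h1 := abs_expect_sub_le_tv_of_mem_unit (q j) (p j)
        (f := fun x => expect (prodPMF (s.piecewise q p)) fun y => f (Function.update y j x))
        fun x => ⟨expect_nonneg _ fun y => (hf _).1, expect_le_const _ fun y => (hf _).2⟩
      have h2 := expect_prodPMF_fubini (s.piecewise q p) j f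
      rw [Finset.piecewise_eq_of_notMem s q p hj] at h2
      rw [← h2] at h1
      exact (abs_sub_le _ _ _).trans (add_le_add h1 ih)
  simpa using key Finset.univ

end TV

/-! ### Smoothness of the values and the potential -/

section Potential

variable {n H : ℕ} {S A : Fin n → Type*} [∀ i, Fintype (S i)] [∀ i, Fintype (A i)]

/-- Every step played with a policy that is `η`-close adds at most `η` to the distance. -/
theorem tv_saLaw_le (M : Game n H S A) (i : Fin n) (σ τ : AgentPolicy H (S i) (A i)) {η : ℝ}
    (hη : ∀ h s, tv (σ h s) (τ h s) ≤ η) (h : Fin H) :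
    tv (saLaw M i σ h) (saLaw M i τ h) ≤ ((h : ℕ) + 1) * η := by
  have hsa : ∀ (h : Fin H) {b : ℝ}, tv (stateLaw M i σ h h.2) (stateLaw M i τ h h.2) ≤ b →
      tv (saLaw M i σ h) (saLaw M i τ h) ≤ b + η := fun h b hb =>
    (tv_bind_le _ _ _ _ fun s => (tv_map_le _ _ _).trans (hη h s)).trans
      (add_le_add_left hb η)
  obtain ⟨m, hm⟩ := h
  induction m with
  | zero =>
    refine (hsa ⟨0, hm⟩ (b := 0) (tv_self _).le).trans_eq ?_
    push_cast
    ring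
  | succ m ih =>
    refine (hsa ⟨m + 1, hm⟩ (b := ((m : ℕ) + 1) * η) ?_).trans_eq ?_
    · have h := tv_bind_le (saLaw M i σ ⟨m, Nat.lt_of_succ_lt hm⟩)
        (saLaw M i τ ⟨m, Nat.lt_of_succ_lt hm⟩)
        (fun x => M.P i ⟨m, Nat.lt_of_succ_lt hm⟩ x.1 x.2)
        (fun x => M.P i ⟨m, Nat.lt_of_succ_lt hm⟩ x.1 x.2) (b := 0) fun x => (tv_self _).le
      rw [← stateLaw_succ, ← stateLaw_succ, add_zero] at h
      exact h.trans (ih (Nat.lt_of_succ_lt hm))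
    · push_cast
      ring

/-- The mixed second difference of `J_i` in the policy of agent `i` and those of the others is of
second order in the size of the change. -/
theorem abs_J_update_sub_sub_le (M : Game n H S A) (π π' : Policy H S A) (i : Fin n)
    (σ : AgentPolicy H (S i) (A i)) {η : ℝ} (h0 : 0 ≤ η)
    (hπ : ∀ j h s, tv (π' j h s) (π j h s) ≤ η) (hσ : ∀ h s, tv (σ h s) (π i h s) ≤ η) :
    |(J M i (Function.update π' i σ) - J M i (Function.update π' i (π i))) -
      (J M i (Function.update π i σ) - J M i π)| ≤ 2 * n * (H : ℝ) ^ 3 * η ^ 2 := by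
  have hJ : J M i π = J M i (Function.update π i (π i)) := by rw [Function.update_eq_self]
  rw [hJ, J_update, J_update, J_update, J_update, ← Finset.sum_sub_distrib,
    ← Finset.sum_sub_distrib, ← Finset.sum_sub_distrib]
  have hterm : ∀ h : Fin H,
      |((expect (saLaw M i σ h) fun x => rbar M π' i h x.1 x.2) -
          expect (saLaw M i (π i) h) fun x => rbar M π' i h x.1 x.2) -
        ((expect (saLaw M i σ h) fun x => rbar M π i h x.1 x.2) -
          expect (saLaw M i (π i) h) fun x => rbar M π i h x.1 x.2)|
        ≤ 2 * n * (H : ℝ) ^ 2 * η ^ 2 := by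
    intro h
    have hh : ((h : ℕ) : ℝ) + 1 ≤ H := by exact_mod_cast h.2
    have hr : ∀ x : S i × A i, |(rbar M π' i h x.1 x.2 - rbar M π i h x.1 x.2) - 0|
        ≤ n * (H * η) := by
      intro x
      rw [sub_zero]
      refine (abs_expect_prodPMF_sub_le _ _ fun y =>
        ⟨M.r_nonneg _ _ _ _, M.r_le_one _ _ _ _⟩).trans ?_
      refine (Finset.sum_le_sum fun j _ => (tv_saLaw_le M j (π' j) (π j) (hπ j) h).trans
        (mul_le_mul_of_nonneg_right hh h0)).trans_eq ?_
      simp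
    have h1 := abs_expect_sub_le_tv (saLaw M i σ h) (saLaw M i (π i) h) 0 hr
    rw [expect_sub, expect_sub] at h1
    have h2 := (tv_saLaw_le M i σ (π i) hσ h).trans (mul_le_mul_of_nonneg_right hh h0)
    have h3 : 2 * (n * (H * η)) * tv (saLaw M i σ h) (saLaw M i (π i) h)
        ≤ 2 * (n * (H * η)) * (H * η) := mul_le_mul_of_nonneg_left h2 (by positivity)
    have h4 : 2 * (n * (H * η)) * (H * η) = 2 * n * (H : ℝ) ^ 2 * η ^ 2 := by ring
    rw [← h4]
    refine le_trans (le_of_eq ?_) (h1.trans h3)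
    congr 1
    ring
  refine (Finset.abs_sum_le_sum_abs _ _).trans
    ((Finset.sum_le_sum fun h _ => hterm h).trans_eq ?_)
  rw [Finset.sum_const, Finset.card_univ, Fintype.card_fin, nsmul_eq_mul]
  ring

variable {M : Game n H S A} {φ : Fin H → (∀ i, S i) → (∀ i, A i) → ℝ}

/-- Under decoupled dynamics the stage potentials add up to a potential of the whole game: with
`φ_h - r_{i,h}` independent of the state and action of agent `i`, the difference of the totals does
not depend on its policy. -/
theorem totalValue_update_sub (hφ : IsStagePotential M φ) (π : Policy H S A) (i : Fin n)
    (σ : AgentPolicy H (S i) (A i)) :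
    totalValue M φ (Function.update π i σ) - totalValue M φ π =
      J M i (Function.update π i σ) - J M i π := by
  have hconst : ∀ σ : AgentPolicy H (S i) (A i),
      totalValue M φ (Function.update π i σ) - J M i (Function.update π i σ) =
        ∑ h, expect (prodPMF fun j => saLaw M j (π j) h) fun y =>
          φ h (fun j => (y j).1) (fun j => (y j).2) -
            M.r i h (fun j => (y j).1) (fun j => (y j).2) := by
    intro σ
    rw [J, totalValue_update, totalValue_update, ← Finset.sum_sub_distrib]
    refine Finset.sum_congr rfl fun h _ => ?_
    rw [← expect_sub]
    refine Eq.trans ?_ (expect_const (saLaw M i σ h) _)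
    congr 1
    funext x
    rw [← expect_sub]
    congr 1
    funext y
    have := hφ i h (fun j => (y j).1) (fun j => (y j).2) x.1 x.2
    linarith
  have h1 := hconst σ
  have h2 := hconst (π i)
  rw [Function.update_eq_self] at h2
  linarith

/-- A simultaneous small change of all policies changes the potential by almost the sum of what
the agents would gain from changing alone. -/
theorem totalValue_sub_ge (hφ : IsStagePotential M φ) (π π' : Policy H S A) {η : ℝ}
    (h0 : 0 ≤ η) (hπ : ∀ j h s, tv (π' j h s) (π j h s) ≤ η) :
    ∑ i, (J M i (Function.update π i (π' i)) - J M i π) - 2 * (n : ℝ) ^ 2 * (H : ℝ) ^ 3 * η ^ 2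
      ≤ totalValue M φ π' - totalValue M φ π := by
  have key : ∀ s : Finset (Fin n),
      ∑ i ∈ s, ((J M i (Function.update π i (π' i)) - J M i π) - 2 * n * (H : ℝ) ^ 3 * η ^ 2)
        ≤ totalValue M φ (s.piecewise π' π) - totalValue M φ π := by
    intro s
    induction s using Finset.induction_on with
    | empty => simp
    | insert i s hi ih =>
      rw [Finset.piecewise_insert, Finset.sum_insert hi]
      have h1 := totalValue_update_sub hφ (s.piecewise π' π) i (π' i)
      have h2 := abs_J_update_sub_sub_le M π (s.piecewise π' π) i (π' i) h0 (fun j h x => by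
        by_cases hj : j ∈ s
        · rw [Finset.piecewise_eq_of_mem s π' π hj]
          exact hπ j h x
        · rw [Finset.piecewise_eq_of_notMem s π' π hj, tv_self]
          exact h0) (hπ i)
      have h3 : Function.update (s.piecewise π' π) i (π i) = s.piecewise π' π := by
        conv_rhs => rw [← Function.update_eq_self i (s.piecewise π' π)]
        rw [Finset.piecewise_eq_of_notMem s π' π hi]
      rw [h3] at h2
      have h4 := (abs_le.mp h2).1
      linarith
  have h := key Finset.univ
  rw [Finset.sum_sub_distrib, Finset.piecewise_univ, Finset.sum_const, Finset.card_univ,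
    Fintype.card_fin, nsmul_eq_mul] at h
  refine le_trans (le_of_eq ?_) h
  ring

/-- Changing the policies one agent at a time changes the potential by at most `H` per agent,
although the stage potentials themselves need not be bounded by `1`. -/
theorem totalValue_sub_le (hφ : IsStagePotential M φ) (π π' : Policy H S A) :
    totalValue M φ π' - totalValue M φ π ≤ n * H := by
  have hJ : ∀ i (ν : Policy H S A), 0 ≤ J M i ν ∧ J M i ν ≤ H := by
    intro i ν
    refine ⟨expect_nonneg _ fun τ => Finset.sum_nonneg fun h _ => M.r_nonneg _ _ _ _,
      expect_le_const _ fun τ =>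
        (Finset.sum_le_sum fun h _ => M.r_le_one _ _ _ _).trans_eq ?_⟩
    simp
  have key : ∀ s : Finset (Fin n),
      totalValue M φ (s.piecewise π' π) - totalValue M φ π ≤ ∑ i ∈ s, (H : ℝ) := by
    intro s
    induction s using Finset.induction_on with
    | empty => simp
    | insert i s hi ih =>
      rw [Finset.piecewise_insert, Finset.sum_insert hi]
      have h1 := totalValue_update_sub hφ (s.piecewise π' π) i (π' i)
      have h2 := hJ i (Function.update (s.piecewise π' π) i (π' i))
      have h3 := hJ i (s.piecewise π' π)
      linarith [h2.2, h3.1]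
  have h := key Finset.univ
  rw [Finset.piecewise_univ] at h
  simpa using h

theorem totalValue_sub_le_potentialRange (hφ : IsStagePotential M φ) (π π' : Policy H S A) :
    totalValue M φ π' - totalValue M φ π ≤ potentialRange M φ := by
  have ha : BddAbove (Set.range fun ν : Policy H S A => totalValue M φ ν) :=
    ⟨totalValue M φ π + n * H, by
      rintro _ ⟨ν, rfl⟩
      linarith [totalValue_sub_le hφ π ν]⟩
  have hb : BddBelow (Set.range fun ν : Policy H S A => totalValue M φ ν) :=
    ⟨totalValue M φ π - n * H, by
      rintro _ ⟨ν, rfl⟩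
      linarith [totalValue_sub_le hφ ν π]⟩
  exact sub_le_sub (le_ciSup ha π') (ciInf_le hb π)

theorem potentialRange_nonneg [∀ i, Nonempty (A i)] (hφ : IsStagePotential M φ) :
    0 ≤ potentialRange M φ := by
  have h := totalValue_sub_le_potentialRange hφ (unifPolicy H S A) (unifPolicy H S A)
  rwa [sub_self] at h

theorem potentialRange_le [∀ i, Nonempty (A i)] (hφ : IsStagePotential M φ) :
    potentialRange M φ ≤ n * H := by
  have : Nonempty (Policy H S A) := ⟨unifPolicy H S A⟩
  have h : (⨆ π : Policy H S A, totalValue M φ π) - n * H ≤ ⨅ π : Policy H S A, totalValue M φ π :=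
    le_ciInf fun π => sub_le_iff_le_add.mpr (ciSup_le fun π' => by
      linarith [totalValue_sub_le hφ π π'])
  unfold potentialRange
  linarith

/-- `π'` arises from `π` by a step of size `η` towards a policy that is greedy, up to `e`, for the
averaged action values of every agent. -/
def IsSoftGreedyStep (M : Game n H S A) (η e : ℝ) (π π' : Policy H S A) : Prop :=
  ∃ (h0 : 0 ≤ η) (h1 : η ≤ 1) (b : ∀ i, Fin H → S i → A i),
    (∀ i h s, π' i h s = mix η h0 h1 (π i h s) (PMF.pure (b i h s))) ∧
      ∀ i (h : Fin H) s a, avgQ M π i h s a ≤ avgQ M π i h s (b i h s) + e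

/-- The ascent of the potential in one step. -/
theorem IsSoftGreedyStep.totalValue_sub_ge [∀ i, Nonempty (A i)] (hH : 0 < H)
    (hφ : IsStagePotential M φ) {c : ℝ} (hc : SufficientExploration M c) {η e : ℝ}
    {π π' : Policy H S A} (hs : IsSoftGreedyStep M η e π π') :
    η * (c * neGap M π - n * H * e) - 2 * (n : ℝ) ^ 2 * (H : ℝ) ^ 3 * η ^ 2
      ≤ totalValue M φ π' - totalValue M φ π := by
  obtain ⟨h0, h1, b, hmix, hb⟩ := hs
  refine le_trans (sub_le_sub_right ?_ _) (MASPI.totalValue_sub_ge hφ π π' h0 fun j h s => by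
    rw [hmix]
    exact tv_mix_left_le h0 h1 _ _)
  refine le_trans (le_of_eq ?_) (Finset.sum_le_sum fun i _ =>
    J_update_mix_sub_ge hH M hc π i h0 h1 (π' i) (b i) (hmix i) (hb i))
  rw [← Finset.mul_sum, Finset.sum_sub_distrib, ← Finset.mul_sum, Finset.sum_const,
    Finset.card_univ, Fintype.card_fin, nsmul_eq_mul, neGap]
  ring

end Potential

/-! ### From the ascent of the potential to the Nash gaps -/

section Ascent

theorem sum_inv_succ_le (T : ℕ) : ∑ t : Fin T, 1 / ((t : ℕ) + 1 : ℝ) ≤ 1 + Real.log T := by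
  have h := harmonic_le_one_add_log T
  rw [Fin.sum_univ_eq_sum_range (fun t => 1 / ((t : ℕ) + 1 : ℝ))]
  simpa [harmonic] using h

theorem sqrt_le_sum_inv_sqrt (T : ℕ) :
    Real.sqrt T ≤ ∑ t : Fin T, 1 / Real.sqrt ((t : ℕ) + 1 : ℝ) := by
  have h : ∑ t : Fin T, 1 / Real.sqrt T ≤ ∑ t : Fin T, 1 / Real.sqrt ((t : ℕ) + 1 : ℝ) := by
    refine Finset.sum_le_sum fun t _ => ?_
    refine one_div_le_one_div_of_le (Real.sqrt_pos.mpr (by positivity)) (Real.sqrt_le_sqrt ?_)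
    exact_mod_cast t.2
  refine le_trans (le_of_eq ?_) h
  rw [Finset.sum_const, Finset.card_univ, Fintype.card_fin, nsmul_eq_mul, mul_one_div,
    Real.div_sqrt]

/-- The inequality behind the threshold for the number of rounds, with `√T = x z`: once
`z ≥ B + log x`, the bound also covers `log z`, which is estimated by the tangent of the logarithm
at `x`. -/
theorem half_log_mul_le {x B z : ℝ} (hx : 1 ≤ x) (hBx : B ≤ x / 2)
    (hz : B + Real.log x ≤ z) (hz0 : 0 < z) :
    B - 1 / 4 + Real.log (x * z) / 2 ≤ z := by
  have hx0 : 0 < x := by linarith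
  have h1 : Real.log z ≤ Real.log x + (z / x - 1) := by
    have h := Real.log_le_sub_one_of_pos (div_pos hz0 hx0)
    rw [Real.log_div hz0.ne' hx0.ne'] at h
    linarith
  have h2 : Real.log x ≤ x - 1 := Real.log_le_sub_one_of_pos hx0
  rw [Real.log_mul hx0.ne' hz0.ne']
  have h3 : (B + Real.log x) / x ≤ 3 / 2 := by
    rw [div_le_iff₀ hx0]; linarith
  have h4 : z / x = (B + Real.log x) / x + (z - (B + Real.log x)) / x := by ring
  have h5 : (z - (B + Real.log x)) / x ≤ z - (B + Real.log x) :=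
    div_le_self (by linarith) hx
  linarith

variable {n H : ℕ} {S A : Fin n → Type*} [∀ i, Fintype (S i)] [∀ i, Fintype (A i)]

theorem SufficientExploration.lt_one [∀ i, Nonempty (A i)] {M : Game n H S A} {c : ℝ}
    (hc : SufficientExploration M c) (hn : 1 ≤ n) (hH : 1 ≤ H) : c < 1 := by
  obtain ⟨s, -⟩ := (M.ρ ⟨0, hn⟩).support_nonempty
  refine (hc.2 (unifPolicy H S A) ⟨0, hn⟩ ⟨0, hH⟩ s).trans_le ?_
  refine expect_le_const _ fun τ => ?_
  split_ifs <;> norm_num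

theorem rpow_three_halves_sq {a : ℝ} (ha : 0 ≤ a) : (a ^ (3 / 2 : ℝ)) ^ 2 = a ^ 3 := by
  rw [← Real.rpow_natCast, ← Real.rpow_mul ha, ← Real.rpow_natCast]
  norm_num

theorem stepSize_succ (n H t : ℕ) :
    stepSize n H (t + 1) =
      1 / (2 * n * (H : ℝ) ^ (3 / 2 : ℝ)) * (1 / Real.sqrt ((t : ℕ) + 1 : ℝ)) := by
  unfold stepSize
  have h : (4 * (n : ℝ) ^ 2 * (H : ℝ) ^ 3 * ((t + 1 : ℕ) : ℝ)) =
      (2 * n * (H : ℝ) ^ (3 / 2 : ℝ)) ^ 2 * ((t : ℝ) + 1) := by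
    rw [mul_pow, rpow_three_halves_sq (Nat.cast_nonneg H)]
    push_cast
    ring
  rw [h, Real.sqrt_mul (by positivity), Real.sqrt_sq (by positivity), one_div_mul_one_div]

variable {M : Game n H S A} {φ : Fin H → (∀ i, S i) → (∀ i, A i) → ℝ}

/-- Telescoping the ascent of the potential along the rounds. The greedy error `c ε / (4 n H)`
costs `ε / 4` per round, half of what the guarantee leaves for it. -/
theorem sum_neGap_le_of_softGreedy [∀ i, Nonempty (A i)] (hn : 1 ≤ n) (hH : 1 ≤ H)
    (hφ : IsStagePotential M φ) {c ε : ℝ} (hc : SufficientExploration M c) {T : ℕ}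
    (p : Fin (T + 1) → Policy H S A)
    (hp : ∀ t : Fin T, IsSoftGreedyStep M (stepSize n H (t + 1)) (c * ε / (4 * n * H))
      (p t.castSucc) (p t.succ)) :
    ∑ t : Fin T, 1 / Real.sqrt ((t : ℕ) + 1 : ℝ) * neGap M (p t.castSucc) ≤
      2 * n * (H : ℝ) ^ (3 / 2 : ℝ) / c * (potentialRange M φ + (1 + Real.log T) / 2) +
        ε / 4 * ∑ t : Fin T, 1 / Real.sqrt ((t : ℕ) + 1 : ℝ) := by
  have hn' : (0 : ℝ) < n := by exact_mod_cast hn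
  have hH' : (0 : ℝ) < H := by exact_mod_cast hH
  set D : ℝ := 2 * n * (H : ℝ) ^ (3 / 2 : ℝ) with hD
  have hD0 : 0 < D := by positivity
  have hD2 : D ^ 2 = 4 * (n : ℝ) ^ 2 * (H : ℝ) ^ 3 := by
    rw [hD, mul_pow, rpow_three_halves_sq hH'.le]; ring
  have hstep : ∀ t : Fin T,
      c / D * (1 / Real.sqrt ((t : ℕ) + 1 : ℝ) * neGap M (p t.castSucc)) -
          c / D * (ε / 4) * (1 / Real.sqrt ((t : ℕ) + 1 : ℝ)) - 1 / 2 * (1 / ((t : ℕ) + 1 : ℝ))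
        ≤ totalValue M φ (p t.succ) - totalValue M φ (p t.castSucc) := by
    intro t
    have h := (hp t).totalValue_sub_ge hH hφ hc
    refine le_trans (le_of_eq ?_) h
    rw [stepSize_succ, ← hD]
    have hs : Real.sqrt ((t : ℕ) + 1 : ℝ) ^ 2 = (t : ℕ) + 1 := Real.sq_sqrt (by positivity)
    have hs0 : 0 < Real.sqrt ((t : ℕ) + 1 : ℝ) := Real.sqrt_pos.mpr (by positivity)
    have h1 : 2 * (n : ℝ) ^ 2 * (H : ℝ) ^ 3 * (1 / D * (1 / Real.sqrt ((t : ℕ) + 1 : ℝ))) ^ 2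
        = 1 / 2 * (1 / ((t : ℕ) + 1 : ℝ)) := by
      rw [mul_pow, one_div_pow, one_div_pow, hs, hD2]
      field_simp
      norm_num
    rw [h1]
    field_simp
  have htel : ∑ t : Fin T, (totalValue M φ (p t.succ) - totalValue M φ (p t.castSucc))
      = totalValue M φ (p (Fin.last T)) - totalValue M φ (p 0) := by
    rw [Finset.sum_sub_distrib]
    have h1 := Fin.sum_univ_succ fun t => totalValue M φ (p t)
    have h2 := Fin.sum_univ_castSucc fun t => totalValue M φ (p t)
    linarith
  have hsum := Finset.sum_le_sum fun t (_ : t ∈ (Finset.univ : Finset (Fin T))) => hstep t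
  rw [htel, Finset.sum_sub_distrib, Finset.sum_sub_distrib, ← Finset.mul_sum, ← Finset.mul_sum,
    ← Finset.mul_sum] at hsum
  -- `2 n² H³ η_t² = 1 / (2 t)` sums to a harmonic number.
  have hrange := totalValue_sub_le_potentialRange hφ (p 0) (p (Fin.last T))
  have hharm := sum_inv_succ_le T
  have hcD : 0 < c / D := div_pos hc.1 hD0
  refine le_of_mul_le_mul_left ?_ hcD
  have h3 : c / D * (D / c * (potentialRange M φ + (1 + Real.log T) / 2) +
      ε / 4 * ∑ t : Fin T, 1 / Real.sqrt ((t : ℕ) + 1 : ℝ)) =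
      (potentialRange M φ + (1 + Real.log T) / 2) +
        c / D * (ε / 4) * ∑ t : Fin T, 1 / Real.sqrt ((t : ℕ) + 1 : ℝ) := by
    have : c / D * (D / c) = 1 := by
      have := hc.1.ne'
      field_simp
    rw [mul_add, ← mul_assoc, this]
    ring
  rw [h3]
  linarith

/-- The number of rounds is at least `(x (B + log x))²` with `x = 8 n H^{3/2} / (c ε)`, which is
what `half_log_mul_le` needs. -/
theorem potential_term_le {n H T : ℕ} (hn : 1 ≤ n) (hH : 1 ≤ H) {c ε ΔΦ : ℝ} (hc0 : 0 < c)
    (hc1 : c ≤ 1) (hε0 : 0 < ε) (hε1 : ε ≤ 1) (hΔ0 : 0 ≤ ΔΦ) (hΔ : ΔΦ ≤ n * H)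
    (hT : 64 * (n : ℝ) ^ 2 * (H : ℝ) ^ 3 *
      ((ΔΦ + 1) / 2 + Real.log (8 * n * (H : ℝ) ^ (3 / 2 : ℝ) * c⁻¹ * ε⁻¹)) ^ 2 /
        (c ^ 2 * ε ^ 2) ≤ (T : ℝ)) :
    0 < T ∧ 2 * n * (H : ℝ) ^ (3 / 2 : ℝ) / c * (ΔΦ + (1 + Real.log T) / 2)
      ≤ ε * Real.sqrt T / 2 := by
  have hn' : (1 : ℝ) ≤ n := by exact_mod_cast hn
  have hH' : (1 : ℝ) ≤ H := by exact_mod_cast hH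
  set x : ℝ := 8 * n * (H : ℝ) ^ (3 / 2 : ℝ) * c⁻¹ * ε⁻¹ with hx
  have hHp : (H : ℝ) ≤ (H : ℝ) ^ (3 / 2 : ℝ) := by
    conv_lhs => rw [← Real.rpow_one (H : ℝ)]
    exact Real.rpow_le_rpow_of_exponent_le hH' (by norm_num)
  have hnH : (1 : ℝ) ≤ n * H := one_le_mul_of_one_le_of_one_le hn' hH'
  have hxnH : 8 * (n * H) ≤ x := by
    have h1 : (n : ℝ) * H ≤ n * (H : ℝ) ^ (3 / 2 : ℝ) := by gcongr
    have h2 : 1 ≤ c⁻¹ * ε⁻¹ :=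
      one_le_mul_of_one_le_of_one_le ((one_le_inv₀ hc0).mpr hc1) ((one_le_inv₀ hε0).mpr hε1)
    have h3 : 8 * (n * (H : ℝ) ^ (3 / 2 : ℝ)) ≤ 8 * (n * (H : ℝ) ^ (3 / 2 : ℝ)) * (c⁻¹ * ε⁻¹) :=
      le_mul_of_one_le_right (by positivity) h2
    have h4 : 8 * (n * (H : ℝ) ^ (3 / 2 : ℝ)) * (c⁻¹ * ε⁻¹) = x := by rw [hx]; ring
    linarith
  have hx1 : 1 ≤ x := by linarith
  have hx0 : 0 < x := by linarith
  have hlog : 0 ≤ Real.log x := Real.log_nonneg hx1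
  set w : ℝ := (ΔΦ + 1) / 2 + Real.log x with hw
  have hw0 : 0 < w := by positivity
  have hT' : (x * w) ^ 2 ≤ T := by
    refine le_trans (le_of_eq ?_) hT
    have : x ^ 2 = 64 * (n : ℝ) ^ 2 * (H : ℝ) ^ 3 / (c ^ 2 * ε ^ 2) := by
      rw [hx, mul_pow, mul_pow, mul_pow, mul_pow, rpow_three_halves_sq (by positivity)]
      field_simp
      norm_num
    rw [mul_pow, this]
    ring
  have hTpos : (0 : ℝ) < T := lt_of_lt_of_le (by positivity) hT'
  refine ⟨by exact_mod_cast hTpos, ?_⟩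
  set y : ℝ := Real.sqrt T with hy
  have hyw : x * w ≤ y := Real.le_sqrt_of_sq_le hT'
  have hlogT : Real.log T = 2 * Real.log y := by
    rw [hy, Real.log_sqrt hTpos.le]; ring
  have hz : w ≤ y / x := by rw [le_div_iff₀ hx0]; linarith
  have h := half_log_mul_le (B := (ΔΦ + 1) / 2) hx1 (by linarith) hz (hw0.trans_le hz)
  rw [mul_div_cancel₀ _ hx0.ne'] at h
  have hcoef : 2 * n * (H : ℝ) ^ (3 / 2 : ℝ) / c = x * ε / 4 := by
    rw [hx]; field_simp; norm_num
  rw [hcoef, hlogT]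
  have h2 : x * (ΔΦ + (1 + 2 * Real.log y) / 2) ≤ 2 * y := by
    have h3 : ΔΦ + (1 + 2 * Real.log y) / 2 ≤ 2 * (y / x) := by linarith
    calc x * (ΔΦ + (1 + 2 * Real.log y) / 2) ≤ x * (2 * (y / x)) := by gcongr
      _ = 2 * y := by field_simp
  calc x * ε / 4 * (ΔΦ + (1 + 2 * Real.log y) / 2)
      = ε / 4 * (x * (ΔΦ + (1 + 2 * Real.log y) / 2)) := by ring
    _ ≤ ε / 4 * (2 * y) := by gcongr
    _ = ε * y / 2 := by ring

/-- If every round makes an almost greedy step, both guarantees hold. -/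
theorem guarantee_of_softGreedy [∀ i, Nonempty (A i)] (hn : 1 ≤ n) (hH : 1 ≤ H)
    (hφ : IsStagePotential M φ) {c ε δ : ℝ} (hc : SufficientExploration M c) (hε0 : 0 < ε)
    (hε1 : ε ≤ 1) {T TJ TK : ℕ} (hT : Thresholds H S A c ε δ (potentialRange M φ) T TJ TK)
    (p : Fin (T + 1) → Policy H S A)
    (hp : ∀ t : Fin T, IsSoftGreedyStep M (stepSize n H (t + 1)) (c * ε / (4 * n * H))
      (p t.castSucc) (p t.succ)) :
    (∑ t : Fin T, 1 / Real.sqrt ((t : ℕ) + 1 : ℝ) * neGap M (p t.castSucc)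
        ≤ ε * Real.sqrt T / 2 + ε * (∑ t : Fin T, 1 / Real.sqrt ((t : ℕ) + 1 : ℝ)) / 2) ∧
      ∃ t : Fin T, neGap M (p t.castSucc) ≤ ε := by
  obtain ⟨hT0, hterm⟩ := potential_term_le hn hH hc.1 (hc.lt_one hn hH).le hε0 hε1
    (potentialRange_nonneg hφ) (potentialRange_le hφ) hT.hTG
  have h1 := sum_neGap_le_of_softGreedy hn hH hφ hc p hp
  have h2 := sqrt_le_sum_inv_sqrt T
  set W : ℝ := ∑ t : Fin T, 1 / Real.sqrt ((t : ℕ) + 1 : ℝ) with hS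
  have hS0 : 0 ≤ W := (Real.sqrt_nonneg _).trans h2
  have hmain : ∑ t : Fin T, 1 / Real.sqrt ((t : ℕ) + 1 : ℝ) * neGap M (p t.castSucc)
      ≤ ε * Real.sqrt T / 2 + ε * W / 2 := by
    nlinarith [mul_nonneg hε0.le hS0]
  refine ⟨hmain, ?_⟩
  by_contra! hcon
  have : Nonempty (Fin T) := ⟨⟨0, hT0⟩⟩
  have h3 : ∑ t : Fin T, 1 / Real.sqrt ((t : ℕ) + 1 : ℝ) * ε
      < ∑ t : Fin T, 1 / Real.sqrt ((t : ℕ) + 1 : ℝ) * neGap M (p t.castSucc) :=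
    Finset.sum_lt_sum_of_nonempty Finset.univ_nonempty fun t _ =>
      mul_lt_mul_of_pos_left (hcon t) (by positivity)
  rw [← Finset.sum_mul, ← hS] at h3
  nlinarith [mul_le_mul_of_nonneg_left h2 hε0.le]

end Ascent

/-! ### Concentration -/

section Hoeffding

variable {α : Type*} [Fintype α]

/-- Hoeffding's inequality for independent copies of a variable with values in `[-1, 1]` and
nonpositive mean: the Chernoff bound with the parameter `v`. -/
theorem toOuterMeasure_sum_ge_le (p : PMF α) (T : ℕ) {X : α → ℝ} (hX : ∀ x, |X x| ≤ 1)
    (hmean : expect p X ≤ 0) {v : ℝ} (hv : 0 ≤ v) :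
    (prodPMF fun _ : Fin T => p).toOuterMeasure {D | T * v ≤ ∑ k, X (D k)} ≤
      ENNReal.ofReal (Real.exp (-(T * v ^ 2 / 2))) := by
  refine (toOuterMeasure_le_ofReal_expect _ _
    (fun D => Real.exp (-(T * v ^ 2)) * ∏ k, Real.exp (X (D k) * v))
    (fun D => by positivity) fun D hD => ?_).trans (ENNReal.ofReal_le_ofReal ?_)
  · rw [← Real.exp_sum, ← Real.exp_add, ← Finset.sum_mul]
    refine Real.one_le_exp ?_
    have : T * v ≤ ∑ k, X (D k) := hD
    nlinarith
  · rw [expect_const_mul, expect_prodPMF_prod (fun _ : Fin T => p) fun _ x => Real.exp (X x * v),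
      Finset.prod_const, Finset.card_univ, Fintype.card_fin]
    have h1 : expect p (fun x => Real.exp (X x * v)) ≤ Real.exp (v ^ 2 / 2) := by
      refine (expect_mono p fun x => Real.exp_mul_le_cosh_add_mul_sinh (hX x) v).trans ?_
      have h2 : expect p (fun x => Real.cosh v + X x * Real.sinh v) =
          Real.cosh v + Real.sinh v * expect p X := by
        rw [expect_add, expect_const, ← expect_const_mul]
        simp only [mul_comm]
      rw [h2]
      have h3 := mul_nonpos_of_nonneg_of_nonpos (Real.sinh_nonneg_iff.mpr hv) hmean
      linarith [Real.cosh_le_exp_half_sq v]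
    refine (mul_le_mul_of_nonneg_left (pow_le_pow_left₀
      (expect_nonneg p fun x => (Real.exp_pos _).le) h1 T) (Real.exp_pos _).le).trans_eq ?_
    rw [← Real.exp_nat_mul, ← Real.exp_add]
    congr 1
    ring

theorem toOuterMeasure_exists_sum_ge_le {ι : Type*} [Fintype ι] (p : PMF α) (T : ℕ)
    {X : ι → α → ℝ} (hX : ∀ j x, |X j x| ≤ 1) (hmean : ∀ j, expect p (X j) ≤ 0) {v : ℝ}
    (hv : 0 ≤ v) :
    (prodPMF fun _ : Fin T => p).toOuterMeasure {D | ∃ j, T * v ≤ ∑ k, X j (D k)} ≤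
      ENNReal.ofReal (Fintype.card ι * Real.exp (-(T * v ^ 2 / 2))) := by
  have h : {D : Fin T → α | ∃ j, T * v ≤ ∑ k, X j (D k)} =
      ⋃ j, {D | T * v ≤ ∑ k, X j (D k)} := by
    ext D; simp
  rw [h]
  refine (MeasureTheory.measure_iUnion_fintype_le _ _).trans ((Finset.sum_le_sum fun j _ =>
    toOuterMeasure_sum_ge_le p T (hX j) (hmean j) hv).trans_eq ?_)
  rw [Finset.sum_const, Finset.card_univ, nsmul_eq_mul, ENNReal.ofReal_mul (Nat.cast_nonneg _),
    ENNReal.ofReal_natCast]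

/-- The relative error of an empirical mean whose number of samples `m` is close to its
expectation `T d`. -/
theorem abs_div_le_of_concentrated {T v κ d m N : ℝ} (hT : 0 ≤ T) (hκ : 0 < κ) (hκd : κ ≤ d)
    (hv0 : 0 ≤ v) (hv : v ≤ κ / 2) (hm : T * d - m < T * v) (hN : |N| ≤ T * v) :
    0 < m ∧ |N / m| ≤ 2 * v / κ := by
  have h1 : T * (κ / 2) < m := by nlinarith
  have hm0 : 0 < m := lt_of_le_of_lt (by positivity) h1
  refine ⟨hm0, ?_⟩
  rw [abs_div, abs_of_pos hm0, div_le_div_iff₀ hm0 hκ]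
  nlinarith

theorem abs_indicator_mul_sub_le {P : Prop} [Decidable P] {x y : ℝ} (hx : 0 ≤ x ∧ x ≤ 1)
    (hy : 0 ≤ y ∧ y ≤ 1) : |(if P then (1 : ℝ) else 0) * (x - y)| ≤ 1 := by
  split_ifs
  · rw [one_mul]
    exact abs_le.mpr ⟨by linarith [hx.1, hy.2], by linarith [hx.2, hy.1]⟩
  · simp

theorem abs_sub_indicator_le {P : Prop} [Decidable P] {x : ℝ} (hx : 0 ≤ x ∧ x ≤ 1) :
    |x - (if P then (1 : ℝ) else 0)| ≤ 1 := by
  split_ifs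
  · exact abs_le.mpr ⟨by linarith [hx.1], by linarith [hx.2]⟩
  · exact abs_le.mpr ⟨by linarith [hx.1], by linarith [hx.2]⟩

end Hoeffding

/-! ### The empirical rewards and transition kernels -/

section Empirical

variable {n H : ℕ} {S A : Fin n → Type*}

theorem countSA_eq_sum {T : ℕ} (D : Dataset T H S A) (i : Fin n) (h : Fin H) (s : S i)
    (a : A i) [DecidableEq (S i × A i)] :
    (countSA D i h s a : ℝ) = ∑ k : Fin T, if D k h i = (s, a) then (1 : ℝ) else 0 := by
  rw [Finset.sum_boole]
  unfold countSA
  congr!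

theorem countSAS_eq_sum {T : ℕ} (D : Dataset T H S A) (i : Fin n) (h : Fin H)
    (hh : (h : ℕ) + 1 < H) (s : S i) (a : A i) (s' : S i) [DecidableEq (S i × A i)]
    [DecidableEq (S i)] :
    (countSAS D i h s a s' : ℝ) = ∑ k : Fin T, (if D k h i = (s, a) then (1 : ℝ) else 0) *
      if (D k ⟨h + 1, hh⟩ i).1 = s' then 1 else 0 := by
  classical
  simp only [← ite_and, ite_mul, one_mul, zero_mul, Finset.sum_boole]
  unfold countSAS
  congr! 4
  simp [hh]

theorem Phat_nonneg {T : ℕ} (D : Dataset T H S A) (i : Fin n) (h : Fin H) (s : S i) (a : A i)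
    (s' : S i) : 0 ≤ Phat D i h s a s' := by
  unfold Phat
  split_ifs <;> positivity

open Classical in
/-- The centred contribution of a trajectory to `countSAS` (`0` at the last step). -/
noncomputable def transDev (M : Game n H S A) (i : Fin n) (h : Fin H) (s : S i) (a : A i)
    (s' : S i) (τ : Traj H S A) : ℝ :=
  if hh : (h : ℕ) + 1 < H then (if τ h i = (s, a) then 1 else 0) *
    ((if (τ ⟨h + 1, hh⟩ i).1 = s' then 1 else 0) - (M.P i h s a s').toReal)
  else 0

open Classical in
/-- The centred contribution of a trajectory to `countSA`, with the sign reversed. -/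
noncomputable def pairDev (M : Game n H S A) (π : Policy H S A) (i : Fin n) (h : Fin H)
    (s : S i) (a : A i) (τ : Traj H S A) : ℝ :=
  (saLaw M i (π i) h (s, a)).toReal - if τ h i = (s, a) then 1 else 0

theorem abs_Phat_sub_le (M : Game n H S A) (π : Policy H S A) {T : ℕ}
    (D : Dataset T H S A) (i : Fin n) (h : Fin H) (hh : (h : ℕ) + 1 < H) (s : S i) (a : A i)
    (s' : S i) {κ v : ℝ} (hκ : 0 < κ) (hκd : κ ≤ (saLaw M i (π i) h (s, a)).toReal)
    (hv0 : 0 ≤ v) (hv : v ≤ κ / 2)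
    (h1 : ∑ k, transDev M i h s a s' (D k) < T * v)
    (h2 : ∑ k, -transDev M i h s a s' (D k) < T * v)
    (h3 : ∑ k, pairDev M π i h s a (D k) < T * v) :
    |Phat D i h s a s' - (M.P i h s a s').toReal| ≤ 2 * v / κ := by
  classical
  have h3' : (T : ℝ) * (saLaw M i (π i) h (s, a)).toReal - countSA D i h s a < T * v := by
    refine lt_of_eq_of_lt ?_ h3
    rw [countSA_eq_sum]
    simp only [pairDev, Finset.sum_sub_distrib, Finset.sum_const, Finset.card_univ,
      Fintype.card_fin, nsmul_eq_mul]
  rw [Finset.sum_neg_distrib] at h2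
  obtain ⟨hm, hN⟩ := abs_div_le_of_concentrated (Nat.cast_nonneg T) hκ hκd hv0 hv h3'
    (abs_le.mpr ⟨by linarith, h1.le⟩ : |∑ k, transDev M i h s a s' (D k)| ≤ T * v)
  refine le_trans (le_of_eq ?_) hN
  have hpos : 1 ≤ countSA D i h s a := by exact_mod_cast hm
  rw [Phat, if_pos hpos]
  congr 1
  rw [eq_div_iff hm.ne', sub_mul, div_mul_cancel₀ _ hm.ne', countSA_eq_sum,
    countSAS_eq_sum D i h hh, Finset.mul_sum, ← Finset.sum_sub_distrib]
  refine Finset.sum_congr rfl fun k _ => ?_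
  rw [transDev, dif_pos hh]
  split_ifs <;> ring

variable [∀ i, Fintype (S i)]

/-- At the last step `countSAS` vanishes, so that the estimated kernel need not be stochastic
there. -/
theorem sum_Phat {T : ℕ} (D : Dataset T H S A) (i : Fin n) (h : Fin H) (hh : (h : ℕ) + 1 < H)
    (s : S i) (a : A i) : ∑ s', Phat D i h s a s' = 1 := by
  classical
  unfold Phat
  by_cases hc : 1 ≤ countSA D i h s a
  · have hc0 : (countSA D i h s a : ℝ) ≠ 0 := by
      exact_mod_cast Nat.one_le_iff_ne_zero.mp hc
    simp only [if_pos hc]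
    rw [← Finset.sum_div, div_eq_one_iff_eq hc0, countSA_eq_sum]
    simp only [countSAS_eq_sum D i h hh]
    rw [Finset.sum_comm]
    simp
  · simp [if_neg hc]

variable [∀ i, Fintype (A i)]

open Classical in
/-- The centred contribution of a trajectory to the sum in `rhat`. -/
noncomputable def rewardDev (M : Game n H S A) (π : Policy H S A) (i : Fin n) (h : Fin H)
    (s : S i) (a : A i) (τ : Traj H S A) : ℝ :=
  (if (τ h i).1 = s then 1 else 0) *
    (M.r i h (Function.update (fun j => (τ h j).1) i s)
      (Function.update (fun j => (τ h j).2) i a) - rbar M π i h s a)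

/-- Given the local state of agent `i`, the other agents are distributed as without this
information, because the local trajectories are independent. -/
theorem expect_rewardDev (M : Game n H S A) (π : Policy H S A) (i : Fin n) (h : Fin H)
    (s : S i) (a : A i) : expect (trajLaw M π) (rewardDev M π i h s a) = 0 := by
  classical
  have h1 := expect_trajLaw_step M π h fun x => (if (x i).1 = s then (1 : ℝ) else 0) *
    (M.r i h (Function.update (fun j => (x j).1) i s)
      (Function.update (fun j => (x j).2) i a) - rbar M π i h s a)
  refine Eq.trans ?_ (h1.trans ?_)
  · congr 1
  -- After Fubini in coordinate `i` the reward no longer depends on the pair of agent `i`.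
  · rw [expect_prodPMF_fubini _ i]
    simp only [update_pair_fst, update_pair_snd, Function.update_idem, Function.update_self]
    simp only [expect_const_mul, expect_sub, expect_const]
    simp [rbar, expect_const]

open Classical in
/-- The centred contribution of a trajectory to `countS`, with the sign reversed. -/
noncomputable def visitDev (M : Game n H S A) (π : Policy H S A) (i : Fin n) (h : Fin H)
    (s : S i) (τ : Traj H S A) : ℝ :=
  visitProb M π i h s - if (τ h i).1 = s then 1 else 0

theorem expect_visitDev (M : Game n H S A) (π : Policy H S A) (i : Fin n) (h : Fin H)
    (s : S i) : expect (trajLaw M π) (visitDev M π i h s) = 0 := by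
  unfold visitDev
  rw [expect_sub, expect_const]
  exact sub_self _

theorem visitProb_mem_unit (M : Game n H S A) (π : Policy H S A) (i : Fin n) (h : Fin H)
    (s : S i) : 0 ≤ visitProb M π i h s ∧ visitProb M π i h s ≤ 1 := by
  rw [visitProb_eq]
  exact toReal_apply_mem_unit _ _

theorem abs_rhat_sub_rbar_le (M : Game n H S A) (π : Policy H S A) {T : ℕ}
    (D : Dataset T H S A) (i : Fin n) (h : Fin H) (s : S i) (a : A i) {c v : ℝ} (hc : 0 < c)
    (hcd : c ≤ visitProb M π i h s) (hv0 : 0 ≤ v) (hv : v ≤ c / 2)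
    (h1 : ∑ k, rewardDev M π i h s a (D k) < T * v)
    (h2 : ∑ k, -rewardDev M π i h s a (D k) < T * v)
    (h3 : ∑ k, visitDev M π i h s (D k) < T * v) :
    |rhat M D i h s a - rbar M π i h s a| ≤ 2 * v / c := by
  classical
  have hcount : (countS D i h s : ℝ) = ∑ k : Fin T, if (D k h i).1 = s then (1 : ℝ) else 0 := by
    rw [Finset.sum_boole]
    unfold countS
    congr!
  have h3' : (T : ℝ) * visitProb M π i h s - countS D i h s < T * v := by
    refine lt_of_eq_of_lt ?_ h3
    rw [hcount]
    simp only [visitDev, Finset.sum_sub_distrib, Finset.sum_const, Finset.card_univ,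
      Fintype.card_fin, nsmul_eq_mul]
  rw [Finset.sum_neg_distrib] at h2
  obtain ⟨hm, hN⟩ := abs_div_le_of_concentrated (Nat.cast_nonneg T) hc hcd hv0 hv h3'
    (abs_le.mpr ⟨by linarith, h1.le⟩ : |∑ k, rewardDev M π i h s a (D k)| ≤ T * v)
  refine le_trans (le_of_eq ?_) hN
  have hpos : 1 ≤ countS D i h s := by exact_mod_cast hm
  rw [rhat, if_pos hpos]
  congr 1
  rw [eq_div_iff hm.ne', sub_mul, div_mul_cancel₀ _ hm.ne', hcount, Finset.mul_sum,
    ← Finset.sum_sub_distrib]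
  refine Finset.sum_congr rfl fun k _ => ?_
  unfold rewardDev
  split_ifs <;> ring

/-- The empirical rewards are uniformly accurate, except with small probability. -/
theorem rhat_concentration (M : Game n H S A) (π : Policy H S A) (T : ℕ) {c v : ℝ}
    (hc : SufficientExploration M c) (hv0 : 0 ≤ v) (hv : v ≤ c / 2) :
    (sampleData M T π).toOuterMeasure
        {D | ¬∀ i h s a, |rhat M D i h s a - rbar M π i h s a| ≤ 2 * v / c} ≤
      ENNReal.ofReal (3 * (H * ∑ i, (Fintype.card (S i) : ℝ) * (Fintype.card (A i) : ℝ)) *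
        Real.exp (-(T * v ^ 2 / 2))) := by
  classical
  set I := Σ i, Fin H × S i × A i with hI
  -- The three families bound the numerators from both sides and the visit counts from below.
  let X : I ⊕ I ⊕ I → Traj H S A → ℝ := Sum.elim
    (fun x => rewardDev M π x.1 x.2.1 x.2.2.1 x.2.2.2) (Sum.elim
    (fun x τ => -rewardDev M π x.1 x.2.1 x.2.2.1 x.2.2.2 τ)
    (fun x => visitDev M π x.1 x.2.1 x.2.2.1))
  have hrew : ∀ i h s a τ, |rewardDev M π i h s a τ| ≤ 1 := fun i h s a τ =>
    abs_indicator_mul_sub_le ⟨M.r_nonneg _ _ _ _, M.r_le_one _ _ _ _⟩ (rbar_bounds M π i h s a)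
  have hX : ∀ j τ, |X j τ| ≤ 1 := by
    rintro (x | x | x) τ
    · exact hrew _ _ _ _ τ
    · exact (abs_neg _).trans_le (hrew _ _ _ _ τ)
    · exact abs_sub_indicator_le (visitProb_mem_unit M π _ _ _)
  have hmean : ∀ j, expect (trajLaw M π) (X j) ≤ 0 := by
    rintro (x | x | x)
    · exact (expect_rewardDev M π _ _ _ _).le
    · refine le_of_eq ?_
      have h := expect_const_mul (trajLaw M π) (-1) (rewardDev M π x.1 x.2.1 x.2.2.1 x.2.2.2)
      rw [expect_rewardDev, mul_zero] at h
      simpa [X] using h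
    · exact (expect_visitDev M π _ _ _).le
  have hprob := toOuterMeasure_exists_sum_ge_le (trajLaw M π) T hX hmean hv0
  have hcard : (Fintype.card (I ⊕ I ⊕ I) : ℝ) =
      3 * (H * ∑ i, (Fintype.card (S i) : ℝ) * (Fintype.card (A i) : ℝ)) := by
    simp only [hI, Fintype.card_sum, Fintype.card_sigma, Fintype.card_prod, Fintype.card_fin]
    push_cast
    rw [← Finset.mul_sum]
    ring
  rw [hcard] at hprob
  refine le_trans (MeasureTheory.measure_mono fun D hD => ?_) hprob
  by_contra hcon
  simp only [Set.mem_ofPred_eq, not_exists, not_le] at hcon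
  refine hD fun i h s a => abs_rhat_sub_rbar_le M π D i h s a hc.1 (hc.2 π i h s).le hv0 hv
    (hcon (Sum.inl ⟨i, h, s, a⟩)) (hcon (Sum.inr (Sum.inl ⟨i, h, s, a⟩)))
    (hcon (Sum.inr (Sum.inr ⟨i, h, s, a⟩)))

theorem expect_transDev (M : Game n H S A) (π : Policy H S A) (i : Fin n) (h : Fin H)
    (s : S i) (a : A i) (s' : S i) :
    expect (trajLaw M π) (transDev M i h s a s') = 0 := by
  classical
  by_cases hh : (h : ℕ) + 1 < H
  · have h1 := expect_trajLaw_transition M π h hh i fun x y => (if x = (s, a) then (1 : ℝ) else 0) *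
      ((if y = s' then 1 else 0) - (M.P i h s a s').toReal)
    refine Eq.trans ?_ (h1.trans ?_)
    · congr 1
      funext τ
      rw [transDev, dif_pos hh]
    · simp only [expect_const_mul, expect_sub, expect_const, expect_ite_eq]
      refine Eq.trans ?_ (expect_const (saLaw M i (π i) h) 0)
      congr 1
      funext x
      split_ifs with hx
      · simp [hx]
      · rw [zero_mul]
  · have h0 : transDev M i h s a s' = fun _ => 0 := funext fun τ => dif_neg hh
    rw [h0, expect_const]

theorem expect_pairDev (M : Game n H S A) (π : Policy H S A) (i : Fin n) (h : Fin H)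
    (s : S i) (a : A i) : expect (trajLaw M π) (pairDev M π i h s a) = 0 := by
  classical
  have h1 := expect_trajLaw_local M π h i fun x => if x = (s, a) then (1 : ℝ) else 0
  rw [expect_ite_eq] at h1
  unfold pairDev
  rw [expect_sub, expect_const, sub_eq_zero, ← h1]

theorem saLaw_apply (M : Game n H S A) (i : Fin n) (σ : AgentPolicy H (S i) (A i)) (h : Fin H)
    (s : S i) (a : A i) :
    (saLaw M i σ h (s, a)).toReal = (stateLaw M i σ h h.2 s).toReal * (σ h s a).toReal := by
  classical
  rw [← expect_ite_eq, expect_saLaw]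
  have h1 : ∀ s', expect (σ h s') (fun a' => if (s', a') = (s, a) then (1 : ℝ) else 0)
      = (σ h s a).toReal * if s' = s then 1 else 0 := by
    intro s'
    by_cases hs : s' = s
    · subst hs
      simp only [Prod.mk.injEq, true_and, if_true, mul_one]
      exact expect_ite_eq _ _
    · simp [hs, expect_const]
  simp only [h1, expect_const_mul, expect_ite_eq]
  ring

theorem card_le_maxCard (X : Fin n → Type*) [∀ i, Fintype (X i)] (i : Fin n) :
    Fintype.card (X i) ≤ maxCard X :=
  Finset.le_sup (f := fun i => Fintype.card (X i)) (Finset.mem_univ i)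

/-- The uniformly random policy visits every local state-action pair. -/
theorem saLaw_unifPolicy_ge [∀ i, Nonempty (A i)] (M : Game n H S A) {c : ℝ}
    (hc : SufficientExploration M c) (i : Fin n) (h : Fin H) (s : S i) (a : A i) :
    c / maxCard A ≤ (saLaw M i (unifPolicy H S A i) h (s, a)).toReal := by
  have h1 := (hc.2 (unifPolicy H S A) i h s).le
  rw [visitProb_eq] at h1
  have h2 : (0 : ℝ) < Fintype.card (A i) := by exact_mod_cast Fintype.card_pos
  have h3 : (Fintype.card (A i) : ℝ) ≤ maxCard A := by exact_mod_cast card_le_maxCard A i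
  have h4 : (unifPolicy H S A i h s a).toReal = 1 / Fintype.card (A i) := by
    simp [unifPolicy]
  rw [saLaw_apply, h4, div_eq_mul_one_div]
  exact mul_le_mul h1 (one_div_le_one_div_of_le h2 h3) (by positivity) (hc.1.le.trans h1)

/-- The empirical transition kernels are uniformly accurate, except with small probability. -/
theorem Phat_concentration [∀ i, Nonempty (A i)] (M : Game n H S A) (T : ℕ) {c v : ℝ}
    (hA : 0 < maxCard A)
    (hc : SufficientExploration M c) (hv0 : 0 ≤ v) (hv : v ≤ c / maxCard A / 2) :
    (sampleData M T (unifPolicy H S A)).toOuterMeasure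
        {D | ¬∀ i (h : Fin H) s a s', (h : ℕ) + 1 < H →
          |Phat D i h s a s' - (M.P i h s a s').toReal| ≤ 2 * v / (c / maxCard A)} ≤
      ENNReal.ofReal (3 * (H * ∑ i, (Fintype.card (S i) : ℝ) ^ 2 * (Fintype.card (A i) : ℝ)) *
        Real.exp (-(T * v ^ 2 / 2))) := by
  classical
  set I := Σ i, Fin H × S i × A i × S i with hI
  set π := unifPolicy H S A with hπ
  -- The three families bound the numerators from both sides and the visit counts from below.
  let X : I ⊕ I ⊕ I → Traj H S A → ℝ := Sum.elim
    (fun x => transDev M x.1 x.2.1 x.2.2.1 x.2.2.2.1 x.2.2.2.2) (Sum.elim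
    (fun x τ => -transDev M x.1 x.2.1 x.2.2.1 x.2.2.2.1 x.2.2.2.2 τ)
    (fun x => pairDev M π x.1 x.2.1 x.2.2.1 x.2.2.2.1))
  have htrans : ∀ i h s a s' τ, |transDev M i h s a s' τ| ≤ 1 := by
    intro i h s a s' τ
    unfold transDev
    by_cases hh : (h : ℕ) + 1 < H
    · rw [dif_pos hh]
      refine abs_indicator_mul_sub_le ?_ (toReal_apply_mem_unit (M.P i h s a) s')
      split_ifs <;> norm_num
    · simp [hh]
  have hX : ∀ j τ, |X j τ| ≤ 1 := by
    rintro (x | x | x) τ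
    · exact htrans _ _ _ _ _ τ
    · exact (abs_neg _).trans_le (htrans _ _ _ _ _ τ)
    · exact abs_sub_indicator_le (toReal_apply_mem_unit _ _)
  have hmean : ∀ j, expect (trajLaw M π) (X j) ≤ 0 := by
    rintro (x | x | x)
    · exact (expect_transDev M π _ _ _ _ _).le
    · refine le_of_eq ?_
      have h := expect_const_mul (trajLaw M π) (-1)
        (transDev M x.1 x.2.1 x.2.2.1 x.2.2.2.1 x.2.2.2.2)
      rw [expect_transDev, mul_zero] at h
      simpa [X] using h
    · exact (expect_pairDev M π _ _ _ _).le
  have hprob := toOuterMeasure_exists_sum_ge_le (trajLaw M π) T hX hmean hv0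
  have hcard : (Fintype.card (I ⊕ I ⊕ I) : ℝ) =
      3 * (H * ∑ i, (Fintype.card (S i) : ℝ) ^ 2 * (Fintype.card (A i) : ℝ)) := by
    simp only [hI, Fintype.card_sum, Fintype.card_sigma, Fintype.card_prod, Fintype.card_fin]
    push_cast
    rw [← Finset.mul_sum]
    have : ∀ i : Fin n, (Fintype.card (S i) : ℝ) * (Fintype.card (A i) * Fintype.card (S i)) =
        (Fintype.card (S i) : ℝ) ^ 2 * (Fintype.card (A i) : ℝ) := fun i => by ring
    simp only [this]
    ring
  rw [hcard] at hprob
  refine le_trans (MeasureTheory.measure_mono fun D hD => ?_) hprob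
  by_contra hcon
  simp only [Set.mem_ofPred_eq, not_exists, not_le] at hcon
  have hκ : 0 < c / maxCard A := div_pos hc.1 (by exact_mod_cast hA)
  refine hD fun i h s a s' hh => abs_Phat_sub_le M π D i h hh s a s' hκ
    (saLaw_unifPolicy_ge M hc i h s a) hv0 hv
    (hcon (Sum.inl ⟨i, h, s, a, s'⟩)) (hcon (Sum.inr (Sum.inl ⟨i, h, s, a, s'⟩)))
    (hcon (Sum.inr (Sum.inr ⟨i, h, s, a, s'⟩)))

end Empirical

/-! ### The estimated action values -/

section Estimation

variable {n H : ℕ} {S A : Fin n → Type*} [∀ i, Fintype (S i)] [∀ i, Fintype (A i)]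

theorem Qhat_eq (M : Game n H S A) {TK TJ : ℕ} (DK : Dataset TK H S A) (D : Dataset TJ H S A)
    (i : Fin n) (π : AgentPolicy H (S i) (A i)) (h : ℕ) (hh : h < H) (s : S i) (a : A i) :
    Qhat M DK D i π h s a = rhat M D i ⟨h, hh⟩ s a +
      if hh' : h + 1 < H then
        ∑ s', Phat DK i ⟨h, hh⟩ s a s' * expect (π ⟨h + 1, hh'⟩ s') (Qhat M DK D i π (h + 1) s')
      else 0 := by
  rw [Qhat, dif_pos hh]
  congr 1
  split_ifs with hh'
  · refine Finset.sum_congr rfl fun s' _ => ?_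
    simp only [expect, Finset.mul_sum, mul_assoc]
  · simp

/-- Accurate rewards and kernels give accurate action values; the errors add up over the remaining
steps. The values are at most `H`, and the estimated kernels are stochastic. -/
theorem abs_Qhat_sub_avgQ_le (M : Game n H S A) {TK TJ : ℕ} (DK : Dataset TK H S A)
    (D : Dataset TJ H S A) (i : Fin n) (π : Policy H S A) {u w : ℝ} (hu0 : 0 ≤ u) (hw0 : 0 ≤ w)
    (hu : ∀ h s a, |rhat M D i h s a - rbar M π i h s a| ≤ u)
    (hw : ∀ (h : Fin H) s a s', (h : ℕ) + 1 < H →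
      |Phat DK i h s a s' - (M.P i h s a s').toReal| ≤ w) (h : ℕ) (hh : h < H) (s : S i)
    (a : A i) :
    |Qhat M DK D i (π i) h s a - avgQ M π i h s a| ≤
      H * (u + Fintype.card (S i) * (w * H)) := by
  set b : ℝ := u + Fintype.card (S i) * (w * H) with hb
  have hb0 : 0 ≤ b := by positivity
  have key : ∀ k h : ℕ, h < H → H - h = k → ∀ s a,
      |Qhat M DK D i (π i) h s a - avgQ M π i h s a| ≤ k * b := by
    intro k
    induction k with
    | zero => intro h hh hk; omega
    | succ k ih =>
      intro h hh hk s a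
      have hQ := avgQ_eq M π i ⟨h, hh⟩ s a
      simp only at hQ
      rw [Qhat_eq M DK D i (π i) h hh, hQ]
      have hr := hu ⟨h, hh⟩ s a
      by_cases hh' : h + 1 < H
      · rw [dif_pos hh']
        set p := Phat DK i ⟨h, hh⟩ s a with hp
        set V := avgV M π i (h + 1) with hV
        set V' : S i → ℝ := fun s' =>
          expect (π i ⟨h + 1, hh'⟩ s') (Qhat M DK D i (π i) (h + 1) s') with hV'
        have hVV : ∀ s', |V' s' - V s'| ≤ k * b := by
          intro s'
          have h1 : V s' = expect (π i ⟨h + 1, hh'⟩ s') (avgQ M π i (h + 1) s') :=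
            avgV_eq M π i ⟨h + 1, hh'⟩ s'
          have h2 := ih (h + 1) hh' (by omega) s'
          rw [h1, hV', ← expect_sub]
          exact abs_le.mpr ⟨const_le_expect _ fun a' => (abs_le.mp (h2 a')).1,
            expect_le_const _ fun a' => (abs_le.mp (h2 a')).2⟩
        have hVb : ∀ s', |V s'| ≤ H := fun s' => by
          have : 0 ≤ V s' ∧ V s' ≤ H :=
            sValue_bounds (M.P i) (rbar M π i) (π i) (rbar_bounds M π i) (h + 1) s'
          exact abs_le.mpr ⟨by linarith [this.1, (Nat.cast_nonneg H : (0 : ℝ) ≤ H)], this.2⟩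
        have hsplit : ∑ s', p s' * V' s' - expect (M.P i ⟨h, hh⟩ s a) V =
            ∑ s', p s' * (V' s' - V s') +
              ∑ s', (p s' - (M.P i ⟨h, hh⟩ s a s').toReal) * V s' := by
          unfold expect
          rw [← Finset.sum_sub_distrib, ← Finset.sum_add_distrib]
          exact Finset.sum_congr rfl fun s' _ => by ring
        have h1 : |∑ s', p s' * (V' s' - V s')| ≤ k * b := by
          refine (Finset.abs_sum_le_sum_abs _ _).trans ?_
          have h2 : ∑ s', p s' * (k * b) = k * b := by
            rw [← Finset.sum_mul, hp, sum_Phat DK i ⟨h, hh⟩ hh', one_mul]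
          rw [← h2]
          refine Finset.sum_le_sum fun s' _ => ?_
          rw [abs_mul, abs_of_nonneg (Phat_nonneg DK i _ s a s')]
          exact mul_le_mul_of_nonneg_left (hVV s') (Phat_nonneg DK i _ s a s')
        have h2 : |∑ s', (p s' - (M.P i ⟨h, hh⟩ s a s').toReal) * V s'| ≤
            Fintype.card (S i) * (w * H) := by
          refine (Finset.abs_sum_le_sum_abs _ _).trans ?_
          refine (Finset.sum_le_sum (g := fun _ => w * H) fun s' _ => ?_).trans_eq (by simp)
          rw [abs_mul]
          exact mul_le_mul (hw ⟨h, hh⟩ s a s' hh') (hVb s') (abs_nonneg _) hw0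
        have h3 : rhat M D i ⟨h, hh⟩ s a + ∑ s', p s' * V' s' -
            (rbar M π i ⟨h, hh⟩ s a + expect (M.P i ⟨h, hh⟩ s a) V) =
            (rhat M D i ⟨h, hh⟩ s a - rbar M π i ⟨h, hh⟩ s a) +
              (∑ s', p s' * V' s' - expect (M.P i ⟨h, hh⟩ s a) V) := by ring
        rw [h3, hsplit]
        refine (abs_add_le _ _).trans ((add_le_add hr ((abs_add_le _ _).trans
          (add_le_add h1 h2))).trans_eq ?_)
        push_cast
        rw [hb]
        ring
      · have hV0 : avgV M π i (h + 1) = fun _ => 0 := by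
          funext s'
          rw [avgV, sValue, dif_neg hh']
        rw [dif_neg hh', hV0, expect_const, add_zero, add_zero]
        refine hr.trans ?_
        have h1 : u ≤ b := by
          rw [hb]
          linarith [show 0 ≤ Fintype.card (S i) * (w * H) by positivity]
        push_cast
        nlinarith [mul_nonneg (Nat.cast_nonneg k : (0 : ℝ) ≤ k) hb0]
  refine (key (H - h) h hh rfl s a).trans (mul_le_mul_of_nonneg_right ?_ hb0)
  exact_mod_cast Nat.sub_le H h

/-- A greedy choice for accurate estimates is almost greedy for the true action values. -/
theorem isSoftGreedyStep_updatePolicy (M : Game n H S A) {g : GreedyRule H S A}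
    (hg : g.IsArgmax) (t : ℕ) {TK TJ : ℕ} (DK : Dataset TK H S A) (D : Dataset TJ H S A)
    (π : Policy H S A) {u w e : ℝ} (hu0 : 0 ≤ u) (hw0 : 0 ≤ w)
    (hu : ∀ i h s a, |rhat M D i h s a - rbar M π i h s a| ≤ u)
    (hw : ∀ i (h : Fin H) s a s', (h : ℕ) + 1 < H →
      |Phat DK i h s a s' - (M.P i h s a s').toReal| ≤ w)
    (he : ∀ i, 2 * (H * (u + Fintype.card (S i) * (w * H))) ≤ e) :
    IsSoftGreedyStep M (stepSize n H t) e π (updatePolicy M g t DK D π) := by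
  refine ⟨stepSize_nonneg n H t, stepSize_le_one n H t,
    fun i h s => g i t h s fun a => Qhat M DK D i (π i) h s a, fun i h s => rfl,
    fun i h s a => ?_⟩
  have hQ := abs_Qhat_sub_avgQ_le M DK D i π hu0 hw0 (hu i) (hw i) h h.2 s
  have h1 := hg i t h s (fun a => Qhat M DK D i (π i) h s a) a
  have h2 := (abs_le.mp (hQ a)).1
  have h3 := (abs_le.mp (hQ (g i t h s fun a => Qhat M DK D i (π i) h s a))).2
  have h4 := he i
  linarith

end Estimation

/-! ### The probability of success -/

section Success

/-- A two-stage experiment fails with at most the probability of a bad first stage plus the failure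
probability after a good one. -/
theorem toOuterMeasure_bind_le {α β : Type*} (p : PMF α) (f : α → PMF β) (B : Set α) (E : Set β)
    {γ : ℝ≥0∞} (h : ∀ a ∉ B, (f a).toOuterMeasure E ≤ γ) :
    (p.bind f).toOuterMeasure E ≤ p.toOuterMeasure B + γ := by
  rw [PMF.toOuterMeasure_bind_apply, PMF.toOuterMeasure_apply]
  have hγ : γ = ∑' a, p a * γ := by rw [ENNReal.tsum_mul_right, p.tsum_coe, one_mul]
  rw [hγ, ← ENNReal.tsum_add]
  refine ENNReal.tsum_le_tsum fun a => ?_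
  by_cases ha : a ∈ B
  · rw [Set.indicator_of_mem ha]
    refine le_add_right (mul_le_of_le_one_right zero_le ?_)
    exact (MeasureTheory.measure_mono (Set.subset_univ E)).trans_eq
      (((f a).toOuterMeasure_apply_eq_one_iff _).mpr (Set.subset_univ _))
  · exact le_add_left (mul_le_mul_right (h a ha) (p a))

variable {n H : ℕ} {S A : Fin n → Type*} [∀ i, Fintype (S i)] [∀ i, Fintype (A i)]

/-- A union bound over the rounds: if, from every policy, a round makes a step in `Q` except with
probability `γ`, then all `T` rounds do so except with probability `T γ`. -/
theorem roundsLaw_not_forall_le (M : Game n H S A) (g : GreedyRule H S A) (π₁ : Policy H S A)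
    (TJ : ℕ) {TK : ℕ} (DK : Dataset TK H S A) (Q : ℕ → Policy H S A → Policy H S A → Prop)
    {γ : ℝ≥0∞}
    (hγ : ∀ t π, (sampleData M TJ π).toOuterMeasure
      {D | ¬Q (t + 1) π (updatePolicy M g (t + 1) DK D π)} ≤ γ) (T : ℕ) :
    (roundsLaw M g π₁ TJ DK T).toOuterMeasure
      {p | ¬∀ t : Fin T, Q (t + 1) (p t.castSucc) (p t.succ)} ≤ T * γ := by
  induction T with
  | zero => simp
  | succ T ih =>
    have hcast : ((T + 1 : ℕ) : ℝ≥0∞) * γ = T * γ + γ := by push_cast; ring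
    rw [hcast, roundsLaw]
    refine (toOuterMeasure_bind_le _ _ _ _ fun p hp => ?_).trans (add_le_add_left ih γ)
    rw [← add_zero γ]
    refine (toOuterMeasure_bind_le _ _ _ _ fun D hD => ?_).trans
      (add_le_add_left (hγ T (p (Fin.last T))) 0)
    rw [PMF.toOuterMeasure_pure_apply, if_neg]
    simp only [Set.mem_ofPred_eq, not_not] at hp hD ⊢
    rw [Fin.forall_fin_succ']
    refine ⟨fun t => ?_, ?_⟩
    · rw [Fin.succ_castSucc, Fin.snoc_castSucc, Fin.snoc_castSucc]
      exact hp t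
    · rw [Fin.succ_last, Fin.snoc_castSucc, Fin.snoc_last]
      exact hD

/-- The number of samples for which the tail bound of `toOuterMeasure_sum_ge_le` is at most
`y⁻¹`. -/
theorem exp_neg_le_inv {N v y : ℝ} (hv : 0 < v) (hy : 0 < y)
    (hN : 2 / v ^ 2 * Real.log y ≤ N) : Real.exp (-(N * v ^ 2 / 2)) ≤ y⁻¹ := by
  rw [← Real.exp_log (inv_pos.mpr hy), Real.log_inv]
  refine Real.exp_le_exp.mpr (neg_le_neg ?_)
  have h : Real.log y = 2 / v ^ 2 * Real.log y * v ^ 2 / 2 := by field_simp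
  rw [h]
  gcongr

theorem maxCard_pos (hn : 1 ≤ n) (X : Fin n → Type*) [∀ i, Fintype (X i)] [∀ i, Nonempty (X i)] :
    0 < maxCard X :=
  Fintype.card_pos.trans_le (card_le_maxCard X ⟨0, hn⟩)

theorem Game.nonempty_state {n H : ℕ} {S A : Fin n → Type*} (M : Game n H S A) (i : Fin n) :
    Nonempty (S i) :=
  ⟨(M.ρ i).support_nonempty.some⟩

/-- Above the thresholds, all rounds make almost greedy steps with probability at least `1 - δ`. -/
theorem maspiLaw_not_softGreedy_le [∀ i, Nonempty (A i)] (hn : 1 ≤ n) (hH : 1 ≤ H)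
    (M : Game n H S A) {c ε δ ΔΦ : ℝ} (hc : SufficientExploration M c) (hε0 : 0 < ε)
    (hε1 : ε ≤ 1) (hδ0 : 0 < δ) {TG TJ TK : ℕ} (hTG : 0 < TG)
    (hT : Thresholds H S A c ε δ ΔΦ TG TJ TK) (π₁ : Policy H S A) {g : GreedyRule H S A}
    (hg : g.IsArgmax) :
    (maspiLaw M g π₁ TG TJ TK).toOuterMeasure
      {p | ¬∀ t : Fin TG, IsSoftGreedyStep M (stepSize n H (t + 1)) (c * ε / (4 * n * H))
        (p t.castSucc) (p t.succ)} ≤ ENNReal.ofReal δ := by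
  have : ∀ i, Nonempty (S i) := M.nonempty_state
  have hn' : (1 : ℝ) ≤ n := by exact_mod_cast hn
  have hH' : (1 : ℝ) ≤ H := by exact_mod_cast hH
  have hG : (1 : ℝ) ≤ TG := by exact_mod_cast hTG
  have hS : (1 : ℝ) ≤ maxCard S := by exact_mod_cast maxCard_pos hn S
  have hA : (1 : ℝ) ≤ maxCard A := by exact_mod_cast maxCard_pos hn A
  have hc0 := hc.1
  have hc1 := (hc.lt_one hn hH).le
  set x : ℝ := ∑ i, (Fintype.card (S i) : ℝ) * (Fintype.card (A i) : ℝ) with hx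
  set z : ℝ := ∑ i, (Fintype.card (S i) : ℝ) ^ 2 * (Fintype.card (A i) : ℝ) with hz
  have hSi : ∀ i, (0 : ℝ) < Fintype.card (S i) := fun i => by exact_mod_cast Fintype.card_pos
  have hAi : ∀ i, (0 : ℝ) < Fintype.card (A i) := fun i => by exact_mod_cast Fintype.card_pos
  have hne : (Finset.univ : Finset (Fin n)).Nonempty := ⟨⟨0, hn⟩, Finset.mem_univ _⟩
  have hx0 : 0 < x := Finset.sum_pos (fun i _ => mul_pos (hSi i) (hAi i)) hne
  have hz0 : 0 < z := Finset.sum_pos (fun i _ => mul_pos (pow_pos (hSi i) 2) (hAi i)) hne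
  -- The deviations `v` and `v'` are chosen to give the constant `2048` in the thresholds.
  set v : ℝ := c ^ 2 * ε / (32 * n * (H : ℝ) ^ 2) with hv
  set v' : ℝ := c ^ 2 * ε / (32 * n * maxCard S * maxCard A * (H : ℝ) ^ 3) with hv'
  have hv0 : 0 < v := by positivity
  have hv'0 : 0 < v' := by positivity
  have hcε : c * ε ≤ 1 := mul_le_one₀ hc1 hε0.le hε1
  have hvc : v ≤ c / 2 := by
    rw [hv, div_le_div_iff₀ (by positivity) two_pos]
    have h1 : (1 : ℝ) ≤ n * (H : ℝ) ^ 2 := one_le_mul_of_one_le_of_one_le hn' (one_le_pow₀ hH')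
    have h2 : c * (c * ε) ≤ c * (n * (H : ℝ) ^ 2) :=
      mul_le_mul_of_nonneg_left (hcε.trans h1) hc0.le
    nlinarith [mul_pos hc0 (lt_of_lt_of_le one_pos h1)]
  have hv'c : v' ≤ c / maxCard A / 2 := by
    rw [hv', div_div, div_le_div_iff₀ (by positivity) (by positivity)]
    have h1 : (1 : ℝ) ≤ n * maxCard S * (H : ℝ) ^ 3 :=
      one_le_mul_of_one_le_of_one_le (one_le_mul_of_one_le_of_one_le hn' hS) (one_le_pow₀ hH')
    have h2 : c * maxCard A * (c * ε) ≤ c * maxCard A * (n * maxCard S * (H : ℝ) ^ 3) :=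
      mul_le_mul_of_nonneg_left (hcε.trans h1) (by positivity)
    nlinarith [mul_pos (mul_pos hc0 (lt_of_lt_of_le one_pos hA)) (lt_of_lt_of_le one_pos h1)]
  have hTJ := hT.hTJ
  rw [← hx] at hTJ
  have hexpJ : Real.exp (-(TJ * v ^ 2 / 2)) ≤ (8 * δ⁻¹ * n * H * TG * x)⁻¹ := by
    refine exp_neg_le_inv hv0 (by positivity) (le_trans (le_of_eq ?_) hTJ)
    rw [hv]
    field_simp
    norm_num
    ring
  have hTK := hT.hTK
  rw [← hz] at hTK
  have hexpK : Real.exp (-(TK * v' ^ 2 / 2)) ≤ (8 * δ⁻¹ * n * H * TG * z)⁻¹ := by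
    refine exp_neg_le_inv hv'0 (by positivity) (le_trans (le_of_eq ?_) hTK)
    rw [hv']
    field_simp
    norm_num
    ring
  set γ : ℝ := 3 * (H * x) * Real.exp (-(TJ * v ^ 2 / 2)) with hγ
  set γ' : ℝ := 3 * (H * z) * Real.exp (-(TK * v' ^ 2 / 2)) with hγ'
  have hγ0 : 0 ≤ γ := by positivity
  have hγ'0 : 0 ≤ γ' := by positivity
  have hγle : TG * γ ≤ 3 / 8 * δ := by
    have h1 : TG * γ ≤ TG * (3 * (H * x) * (8 * δ⁻¹ * n * H * TG * x)⁻¹) := by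
      rw [hγ]; gcongr
    have h2 : TG * (3 * (H * x) * (8 * δ⁻¹ * n * H * TG * x)⁻¹) = 3 / 8 * δ / n := by
      field_simp
    exact (h1.trans_eq h2).trans (div_le_self (by positivity) hn')
  have hγ'le : γ' ≤ 3 / 8 * δ := by
    have h1 : γ' ≤ 3 * (H * z) * (8 * δ⁻¹ * n * H * TG * z)⁻¹ := by
      rw [hγ']; gcongr
    have h2 : 3 * (H * z) * (8 * δ⁻¹ * n * H * TG * z)⁻¹ = 3 / 8 * δ / (n * TG) := by
      field_simp
    exact (h1.trans_eq h2).trans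
      (div_le_self (by positivity) (one_le_mul_of_one_le_of_one_le hn' hG))
  have herr : ∀ i, 2 * (H * (2 * v / c + Fintype.card (S i) * (2 * v' / (c / maxCard A) * H))) ≤
      c * ε / (4 * n * H) := by
    intro i
    have h1 : (Fintype.card (S i) : ℝ) ≤ maxCard S := by exact_mod_cast card_le_maxCard S i
    have h2 : 2 * (H * (2 * v / c + Fintype.card (S i) * (2 * v' / (c / maxCard A) * H))) ≤
        2 * (H * (2 * v / c + maxCard S * (2 * v' / (c / maxCard A) * H))) := by
      gcongr
    refine h2.trans_eq ?_
    rw [hv, hv']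
    field_simp
    norm_num
  have hmain : (maspiLaw M g π₁ TG TJ TK).toOuterMeasure
      {p | ¬∀ t : Fin TG, IsSoftGreedyStep M (stepSize n H (t + 1)) (c * ε / (4 * n * H))
        (p t.castSucc) (p t.succ)} ≤ ENNReal.ofReal γ' + TG * ENNReal.ofReal γ := by
    refine (toOuterMeasure_bind_le _ _ _ _ fun DK hDK => ?_).trans
      (add_le_add_left (Phat_concentration M TK (maxCard_pos hn A) hc hv'0.le hv'c) _)
    simp only [Set.mem_ofPred_eq, not_not] at hDK
    refine roundsLaw_not_forall_le M g π₁ TJ DK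
      (fun t π π' => IsSoftGreedyStep M (stepSize n H t) (c * ε / (4 * n * H)) π π')
      (fun t π => ?_) TG
    refine le_trans (MeasureTheory.measure_mono fun D hD => ?_)
      (rhat_concentration M π TJ hc hv0.le hvc)
    simp only [Set.mem_ofPred_eq] at hD ⊢
    exact fun hgood => hD (isSoftGreedyStep_updatePolicy M hg (t + 1) DK D π (by positivity)
      (by positivity) hgood hDK herr)
  refine hmain.trans ?_
  rw [← ENNReal.ofReal_natCast, ← ENNReal.ofReal_mul (Nat.cast_nonneg _),
    ← ENNReal.ofReal_add hγ'0 (by positivity)]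
  exact ENNReal.ofReal_le_ofReal (by linarith)

end Success

/-! ### The sample complexity -/

section Complexity

theorem log_le_of_le_two_pow_mul_pow {y N : ℝ} (a b : ℕ) (hy : 0 < y) (hN : 1 ≤ N) (hab : b ≤ a)
    (h : y ≤ 2 ^ a * N ^ b) : Real.log y ≤ a * (1 + Real.log N) := by
  have hN0 : 0 < N := by linarith
  have h1 := Real.log_le_log hy h
  rw [Real.log_mul (by positivity) (by positivity), Real.log_pow, Real.log_pow] at h1
  have h2 : Real.log 2 ≤ 1 := by linarith [Real.log_two_lt_d9]
  have h3 : (b : ℝ) * Real.log N ≤ a * Real.log N :=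
    mul_le_mul_of_nonneg_right (by exact_mod_cast hab) (Real.log_nonneg hN)
  have h4 : (a : ℝ) * Real.log 2 ≤ a * 1 := mul_le_mul_of_nonneg_left h2 (Nat.cast_nonneg a)
  linarith

theorem ceil_le_succ_mul {x k y : ℝ} (hx : x ≤ k * y) (hx0 : 0 ≤ x) (hy : 1 ≤ y) :
    (⌈x⌉₊ : ℝ) ≤ (k + 1) * y := by
  have := (Nat.ceil_lt_add_one hx0).le
  linarith

/-- The bound on the samples for the least admissible parameters, where `s` and `a` stand for the
largest numbers of local states and actions, and `X`, `Y` for the sums in the thresholds. All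
logarithms are bounded by a multiple of `L = 1 + log N`. -/
theorem exists_samples_le {n H s a c ε δ ΔΦ X Y : ℝ} (hn : 1 ≤ n) (hH : 1 ≤ H) (hs : 1 ≤ s)
    (ha : 1 ≤ a) (hc0 : 0 < c) (hc1 : c ≤ 1) (hε0 : 0 < ε) (hε1 : ε ≤ 1) (hδ0 : 0 < δ)
    (hδ1 : δ ≤ 1) (hΔ0 : 0 ≤ ΔΦ) (hΔ : ΔΦ ≤ n * H) (hX0 : 0 < X) (hX : X ≤ n * s ^ 2 * a)
    (hY0 : 0 < Y) (hY : Y ≤ n * s ^ 2 * a) :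
    ∃ TG TJ TK : ℕ,
      64 * n ^ 2 * H ^ 3 * ((ΔΦ + 1) / 2 + Real.log (8 * n * H ^ (3 / 2 : ℝ) * c⁻¹ * ε⁻¹)) ^ 2 /
        (c ^ 2 * ε ^ 2) ≤ (TG : ℝ) ∧
      2048 * n ^ 2 * H ^ 4 * Real.log (8 * δ⁻¹ * n * H * TG * X) / (c ^ 4 * ε ^ 2) ≤ (TJ : ℝ) ∧
      2048 * n ^ 2 * s ^ 2 * a ^ 2 * H ^ 6 * Real.log (8 * δ⁻¹ * n * H * TG * Y) /
        (c ^ 4 * ε ^ 2) ≤ (TK : ℝ) ∧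
      (TG : ℝ) * TJ + TK ≤ 1025 * 32769 * (1 + Real.log (n * H * s * a / (c * ε * δ))) ^ 3 *
        ((1 + ΔΦ) ^ 2 * n ^ 4 * H ^ 7 / (c ^ 6 * ε ^ 4) +
          n ^ 2 * s ^ 2 * a ^ 2 * H ^ 6 / (c ^ 4 * ε ^ 2)) := by
  have hci : 1 ≤ c⁻¹ := (one_le_inv₀ hc0).mpr hc1
  have hεi : 1 ≤ ε⁻¹ := (one_le_inv₀ hε0).mpr hε1
  have hδi : 1 ≤ δ⁻¹ := (one_le_inv₀ hδ0).mpr hδ1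
  have hN : n * H * s * a / (c * ε * δ) = n * H * s * a * c⁻¹ * ε⁻¹ * δ⁻¹ := by
    field_simp
  set N : ℝ := n * H * s * a / (c * ε * δ) with hNdef
  have hN1 : 1 ≤ N := by
    rw [hN]
    repeat' first | assumption | refine one_le_mul_of_one_le_of_one_le ?_ ?_
  set L : ℝ := 1 + Real.log N with hL
  have hL1 : 1 ≤ L := by linarith [Real.log_nonneg hN1]
  have hLN : L ≤ N := by linarith [Real.log_le_sub_one_of_pos (lt_of_lt_of_le one_pos hN1)]
  set R : ℝ := 1 + ΔΦ with hR
  have hR1 : 1 ≤ R := by linarith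
  have hRnH : R ≤ 2 * (n * H) := by linarith [one_le_mul_of_one_le_of_one_le hn hH]
  -- The number of rounds: `log x ≤ 3 L` because `x ≤ 8 N²`.
  set x : ℝ := 8 * n * H ^ (3 / 2 : ℝ) * c⁻¹ * ε⁻¹ with hx
  have hHp : H ^ (3 / 2 : ℝ) ≤ H ^ 2 := by
    rw [← Real.rpow_natCast]
    exact Real.rpow_le_rpow_of_exponent_le hH (by norm_num)
  have hxN : x ≤ 2 ^ 3 * N ^ 2 := by
    have h1 : x ≤ 8 * n ^ 2 * H ^ 2 * (c⁻¹) ^ 2 * (ε⁻¹) ^ 2 := by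
      rw [hx]
      gcongr <;> exact le_self_pow₀ (by assumption) two_ne_zero
    have h2 : 8 * n ^ 2 * H ^ 2 * (c⁻¹) ^ 2 * (ε⁻¹) ^ 2 ≤
        8 * n ^ 2 * H ^ 2 * (c⁻¹) ^ 2 * (ε⁻¹) ^ 2 * (s * a * δ⁻¹) ^ 2 :=
      le_mul_of_one_le_right (by positivity) (one_le_pow₀
        (one_le_mul_of_one_le_of_one_le (one_le_mul_of_one_le_of_one_le hs ha) hδi))
    refine (h1.trans h2).trans_eq ?_
    rw [hN]
    ring
  have hx1 : 1 ≤ x := by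
    have hHp1 : 1 ≤ H ^ (3 / 2 : ℝ) := Real.one_le_rpow hH (by norm_num)
    rw [hx]
    repeat' first | assumption | refine one_le_mul_of_one_le_of_one_le ?_ ?_
    norm_num
  have hlogx : Real.log x ≤ 3 * L :=
    log_le_of_le_two_pow_mul_pow 3 2 (by linarith) hN1 (by norm_num) hxN
  set w : ℝ := (ΔΦ + 1) / 2 + Real.log x with hw
  have hw0 : 0 < w := by linarith [Real.log_nonneg hx1]
  have hwRL : w ≤ 4 * (R * L) := by nlinarith
  set G : ℝ := 64 * n ^ 2 * H ^ 3 * w ^ 2 / (c ^ 2 * ε ^ 2) with hG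
  set yG : ℝ := R ^ 2 * L ^ 2 * n ^ 2 * H ^ 3 * (c⁻¹) ^ 2 * (ε⁻¹) ^ 2 with hyG
  have hyG1 : 1 ≤ yG := by
    rw [hyG]
    repeat' first | assumption | refine one_le_mul_of_one_le_of_one_le ?_ ?_ |
      refine one_le_pow₀ ?_
  have hG0 : 0 < G := by positivity
  have hGy : G ≤ 1024 * yG := by
    have h1 : G ≤ 64 * n ^ 2 * H ^ 3 * (4 * (R * L)) ^ 2 / (c ^ 2 * ε ^ 2) := by
      rw [hG]; gcongr
    refine h1.trans_eq ?_
    rw [hyG]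
    field_simp
    norm_num
  set TG : ℕ := ⌈G⌉₊ with hTG
  have hTG0 : (0 : ℝ) < TG := by exact_mod_cast Nat.ceil_pos.mpr hG0
  have hTGle : (TG : ℝ) ≤ 1025 * yG := by
    have := ceil_le_succ_mul hGy hG0.le hyG1
    linarith
  -- The logarithms in the other two thresholds: `1 + ΔΦ ≤ 2 n H` and `L ≤ N` make their arguments
  -- at most `2¹⁶ N⁸`.
  have hlog : ∀ W : ℝ, 0 < W → W ≤ n * s ^ 2 * a →
      Real.log (8 * δ⁻¹ * n * H * TG * W) ≤ 16 * L := by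
    intro W hW0 hW
    refine log_le_of_le_two_pow_mul_pow 16 8 (by positivity) hN1 (by norm_num) ?_
    have h1 : 8 * δ⁻¹ * n * H * TG * W ≤ 8 * δ⁻¹ * n * H * (1025 *
        ((2 * (n * H)) ^ 2 * N ^ 2 * n ^ 2 * H ^ 3 * (c⁻¹) ^ 2 * (ε⁻¹) ^ 2)) * (n * s ^ 2 * a) := by
      refine mul_le_mul (mul_le_mul_of_nonneg_left (hTGle.trans ?_) (by positivity)) hW hW0.le
        (by positivity)
      rw [hyG]
      gcongr
    refine h1.trans ?_
    have h2 : n ^ 6 * H ^ 6 * s ^ 2 * a ^ 1 * (c⁻¹) ^ 2 * (ε⁻¹) ^ 2 * (δ⁻¹) ^ 1 ≤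
        n ^ 6 * H ^ 6 * s ^ 6 * a ^ 6 * (c⁻¹) ^ 6 * (ε⁻¹) ^ 6 * (δ⁻¹) ^ 6 := by
      gcongr <;> first | assumption | norm_num
    have h3 : n ^ 6 * H ^ 6 * s ^ 6 * a ^ 6 * (c⁻¹) ^ 6 * (ε⁻¹) ^ 6 * (δ⁻¹) ^ 6 = N ^ 6 := by
      rw [hN]; ring
    rw [h3] at h2
    calc 8 * δ⁻¹ * n * H * (1025 * ((2 * (n * H)) ^ 2 * N ^ 2 * n ^ 2 * H ^ 3 * (c⁻¹) ^ 2 *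
          (ε⁻¹) ^ 2)) * (n * s ^ 2 * a)
        = 32800 * (n ^ 6 * H ^ 6 * s ^ 2 * a ^ 1 * (c⁻¹) ^ 2 * (ε⁻¹) ^ 2 * (δ⁻¹) ^ 1) * N ^ 2 := by
          ring
      _ ≤ 2 ^ 16 * N ^ 6 * N ^ 2 := by
          gcongr
          norm_num
      _ = 2 ^ 16 * N ^ 8 := by ring
  set yJ : ℝ := L * n ^ 2 * H ^ 4 * (c⁻¹) ^ 4 * (ε⁻¹) ^ 2 with hyJ
  set yK : ℝ := L * n ^ 2 * s ^ 2 * a ^ 2 * H ^ 6 * (c⁻¹) ^ 4 * (ε⁻¹) ^ 2 with hyK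
  have hyJ1 : 1 ≤ yJ := by
    rw [hyJ]
    repeat' first | assumption | refine one_le_mul_of_one_le_of_one_le ?_ ?_ |
      refine one_le_pow₀ ?_
  have hyK1 : 1 ≤ yK := by
    rw [hyK]
    repeat' first | assumption | refine one_le_mul_of_one_le_of_one_le ?_ ?_ |
      refine one_le_pow₀ ?_
  set GJ : ℝ := 2048 * n ^ 2 * H ^ 4 * Real.log (8 * δ⁻¹ * n * H * TG * X) / (c ^ 4 * ε ^ 2)
    with hGJ
  set GK : ℝ := 2048 * n ^ 2 * s ^ 2 * a ^ 2 * H ^ 6 * Real.log (8 * δ⁻¹ * n * H * TG * Y) /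
    (c ^ 4 * ε ^ 2) with hGK
  have hGJy : GJ ≤ 32768 * yJ := by
    have h1 : GJ ≤ 2048 * n ^ 2 * H ^ 4 * (16 * L) / (c ^ 4 * ε ^ 2) := by
      rw [hGJ]
      gcongr
      exact hlog X hX0 hX
    refine h1.trans_eq ?_
    rw [hyJ]
    field_simp
    norm_num
  have hGKy : GK ≤ 32768 * yK := by
    have h1 : GK ≤ 2048 * n ^ 2 * s ^ 2 * a ^ 2 * H ^ 6 * (16 * L) / (c ^ 4 * ε ^ 2) := by
      rw [hGK]
      gcongr
      exact hlog Y hY0 hY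
    refine h1.trans_eq ?_
    rw [hyK]
    field_simp
    norm_num
  have hceil : ∀ u y : ℝ, u ≤ 32768 * y → 1 ≤ y → (⌈u⌉₊ : ℝ) ≤ 32769 * y := by
    intro u y hu hy
    rcases le_total 0 u with h0 | h0
    · have := ceil_le_succ_mul hu h0 hy
      linarith
    · rw [Nat.ceil_eq_zero.mpr h0, Nat.cast_zero]
      positivity
  refine ⟨TG, ⌈GJ⌉₊, ⌈GK⌉₊, Nat.le_ceil G, Nat.le_ceil GJ, Nat.le_ceil GK, ?_⟩
  have hJle := hceil GJ yJ hGJy hyJ1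
  have hKle := hceil GK yK hGKy hyK1
  have h1 : (TG : ℝ) * ⌈GJ⌉₊ ≤ 1025 * yG * (32769 * yJ) :=
    mul_le_mul hTGle hJle (Nat.cast_nonneg _) (by positivity)
  have h2 : 1025 * yG * (32769 * yJ) =
      1025 * 32769 * L ^ 3 * (R ^ 2 * n ^ 4 * H ^ 7 / (c ^ 6 * ε ^ 4)) := by
    rw [hyG, hyJ]
    field_simp
  have h3 : 32769 * yK ≤
      1025 * 32769 * L ^ 3 * (n ^ 2 * s ^ 2 * a ^ 2 * H ^ 6 / (c ^ 4 * ε ^ 2)) := by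
    have h4 : yK = L * (n ^ 2 * s ^ 2 * a ^ 2 * H ^ 6 / (c ^ 4 * ε ^ 2)) := by
      rw [hyK]
      field_simp
    have h5 : L ≤ L ^ 3 := le_self_pow₀ hL1 (by norm_num)
    have h6 : 32769 * L ≤ 1025 * 32769 * L ^ 3 := by linarith
    rw [h4, ← mul_assoc]
    exact mul_le_mul_of_nonneg_right h6 (by positivity)
  rw [mul_add]
  linarith

variable {n H : ℕ} {S A : Fin n → Type*} [∀ i, Fintype (S i)] [∀ i, Fintype (A i)]

theorem sum_card_mul_le (S A : Fin n → Type*) [∀ i, Fintype (S i)] [∀ i, Fintype (A i)] (j : ℕ)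
    (hj : j ≤ 2) (hS : 1 ≤ maxCard S) :
    ∑ i, (Fintype.card (S i) : ℝ) ^ j * (Fintype.card (A i) : ℝ) ≤
      n * (maxCard S : ℝ) ^ 2 * maxCard A := by
  have h : ∀ i, (Fintype.card (S i) : ℝ) ^ j * (Fintype.card (A i) : ℝ) ≤
      (maxCard S : ℝ) ^ 2 * maxCard A := by
    intro i
    have h1 : (Fintype.card (S i) : ℝ) ≤ maxCard S := by exact_mod_cast card_le_maxCard S i
    have h2 : (Fintype.card (A i) : ℝ) ≤ maxCard A := by exact_mod_cast card_le_maxCard A i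
    have h3 : (Fintype.card (S i) : ℝ) ^ j ≤ (maxCard S : ℝ) ^ 2 :=
      (pow_le_pow_left₀ (Nat.cast_nonneg _) h1 j).trans
        (pow_le_pow_right₀ (by exact_mod_cast hS) hj)
    exact mul_le_mul h3 h2 (Nat.cast_nonneg _) (by positivity)
  refine (Finset.sum_le_sum fun i _ => h i).trans_eq ?_
  rw [Finset.sum_const, Finset.card_univ, Fintype.card_fin, nsmul_eq_mul, mul_assoc]

/-- The thresholds, rounded up, respect the claimed sample complexity. -/
theorem exists_thresholds_sampleCount_le [∀ i, Nonempty (A i)] (hn : 1 ≤ n) (hH : 1 ≤ H)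
    (M : Game n H S A) {φ : Fin H → (∀ i, S i) → (∀ i, A i) → ℝ} (hφ : IsStagePotential M φ)
    {c ε δ : ℝ} (hc : SufficientExploration M c) (hε0 : 0 < ε) (hε1 : ε ≤ 1) (hδ0 : 0 < δ)
    (hδ1 : δ ≤ 1) :
    ∃ TG TJ TK : ℕ,
      Thresholds H S A c ε δ (potentialRange M φ) TG TJ TK ∧
      (sampleCount TG TJ TK : ℝ) ≤
        1025 * 32769 * (1 + Real.log (n * H * maxCard S * maxCard A / (c * ε * δ))) ^ 3 *
          ((1 + potentialRange M φ) ^ 2 * (n : ℝ) ^ 4 * (H : ℝ) ^ 7 / (c ^ 6 * ε ^ 4)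
            + (n : ℝ) ^ 2 * (maxCard S : ℝ) ^ 2 * (maxCard A : ℝ) ^ 2
                * (H : ℝ) ^ 6 / (c ^ 4 * ε ^ 2)) := by
  have : ∀ i, Nonempty (S i) := M.nonempty_state
  have hS := maxCard_pos hn S
  have hA := maxCard_pos hn A
  have hne : (Finset.univ : Finset (Fin n)).Nonempty := ⟨⟨0, hn⟩, Finset.mem_univ _⟩
  have hpos : ∀ j : ℕ, 0 < ∑ i, (Fintype.card (S i) : ℝ) ^ j * (Fintype.card (A i) : ℝ) :=
    fun j => Finset.sum_pos (fun i _ => mul_pos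
      (pow_pos (by exact_mod_cast Fintype.card_pos) j) (by exact_mod_cast Fintype.card_pos)) hne
  have h1 := hpos 1
  have h2 := sum_card_mul_le S A 1 one_le_two hS
  simp only [pow_one] at h1 h2
  obtain ⟨TG, TJ, TK, hG, hJ, hK, hcount⟩ := exists_samples_le (n := n) (H := H) (s := maxCard S)
    (a := maxCard A) (by exact_mod_cast hn) (by exact_mod_cast hH) (by exact_mod_cast hS)
    (by exact_mod_cast hA) hc.1 (hc.lt_one hn hH).le hε0 hε1 hδ0 hδ1 (potentialRange_nonneg hφ)
    (potentialRange_le hφ) h1 h2 (hpos 2) (sum_card_mul_le S A 2 le_rfl hS)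
  refine ⟨TG, TJ, TK, ⟨hG, hJ, hK⟩, ?_⟩
  unfold sampleCount
  push_cast
  exact hcount

end Complexity

end MASPI

theorem mainTheorem2 :
    ∃ (C : ℝ) (k : ℕ), 0 < C ∧
      ∀ (n H : ℕ) (_ : 1 ≤ n) (_ : 1 ≤ H) (S A : Fin n → Type*)
        [∀ i, Fintype (S i)] [∀ i, Fintype (A i)] [∀ i, Nonempty (A i)]
        (M : MASPI.Game n H S A) (φ : Fin H → (∀ i, S i) → (∀ i, A i) → ℝ)
        (_ : MASPI.IsStagePotential M φ)
        (c : ℝ) (_ : MASPI.SufficientExploration M c)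
        (ε δ : ℝ) (_ : 0 < ε) (_ : ε ≤ 1) (_ : 0 < δ) (_ : δ < 1),
        -- the guarantee for every choice of parameters above the thresholds
        (∀ (TG TJ TK : ℕ),
          MASPI.Thresholds H S A c ε δ (MASPI.potentialRange M φ) TG TJ TK →
          ∀ (π₁ : MASPI.Policy H S A) (g : MASPI.GreedyRule H S A), g.IsArgmax →
            ENNReal.ofReal (1 - δ) ≤
              (MASPI.maspiLaw M g π₁ TG TJ TK).toOuterMeasure
                {p | (∑ t : Fin TG,
                        1 / Real.sqrt ((t : ℕ) + 1 : ℝ) * MASPI.neGap M (p t.castSucc)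
                          ≤ ε * Real.sqrt TG / 2
                            + ε * (∑ t : Fin TG, 1 / Real.sqrt ((t : ℕ) + 1 : ℝ)) / 2) ∧
                     ∃ t : Fin TG, MASPI.neGap M (p t.castSucc) ≤ ε}) ∧
        -- the sample complexity
        ∃ TG TJ TK : ℕ,
          MASPI.Thresholds H S A c ε δ (MASPI.potentialRange M φ) TG TJ TK ∧
          (MASPI.sampleCount TG TJ TK : ℝ) ≤
            C * (1 + Real.log (n * H * MASPI.maxCard S * MASPI.maxCard A / (c * ε * δ))) ^ k *
              ((1 + MASPI.potentialRange M φ) ^ 2 * (n : ℝ) ^ 4 * (H : ℝ) ^ 7 / (c ^ 6 * ε ^ 4)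
                + (n : ℝ) ^ 2 * (MASPI.maxCard S : ℝ) ^ 2 * (MASPI.maxCard A : ℝ) ^ 2
                    * (H : ℝ) ^ 6 / (c ^ 4 * ε ^ 2)) := by
  refine ⟨1025 * 32769, 3, by norm_num, ?_⟩
  intro n H hn hH S A _ _ _ M φ hφ c hc ε δ hε0 hε1 hδ0 hδ1
  refine ⟨fun TG TJ TK hT π₁ g hg => ?_,
    MASPI.exists_thresholds_sampleCount_le hn hH M hφ hc hε0 hε1 hδ0 hδ1.le⟩
  have hTG := (MASPI.potential_term_le hn hH hc.1 (hc.lt_one hn hH).le hε0 hε1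
    (MASPI.potentialRange_nonneg hφ) (MASPI.potentialRange_le hφ) hT.hTG).1
  have hfail := MASPI.maspiLaw_not_softGreedy_le hn hH M hc hε0 hε1 hδ0 hTG hT π₁ hg
  rw [ENNReal.ofReal_sub _ hδ0.le, ENNReal.ofReal_one, tsub_le_iff_right]
  refine le_trans ?_ (add_le_add_right hfail _)
  rw [← (PMF.toOuterMeasure_apply_eq_one_iff (MASPI.maspiLaw M g π₁ TG TJ TK) Set.univ).mpr
    (Set.subset_univ _)]
  refine le_trans (MeasureTheory.measure_mono fun p _ => ?_) (MeasureTheory.measure_union_le _ _)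
  by_cases hp : ∀ t : Fin TG, MASPI.IsSoftGreedyStep M (MASPI.stepSize n H (t + 1))
      (c * ε / (4 * n * H)) (p t.castSucc) (p t.succ)
  · exact Or.inl (MASPI.guarantee_of_softGreedy hn hH hφ hc hε0 hε1 hT p hp)
  · exact Or.inr hp
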